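/- Let $d,m,n\in\mathbb N$ and let $\Delta\subset\mathbb R^d$ be a Jordan-measurable compact connected set with the origin in its interior; put $\Delta(r)=r\Delta$ for $r>0$. A measurable function $L:(0,\infty)\to(0,\infty)$ is slowly varying at infinity if $L(tr)/L(r)\to1$ as $r\to\infty$ for every $t>0$. Let $\gamma_{m+n}$ be the standard Gaussian measure on $\mathbb R^{m+n}$, let $H_k$ be the Hermite polynomials orthogonal with respect to the standard normal law, with leading coefficient $1$, and for a multi-index $v=(k_1,\dots,k_{m+n})$ of non-negative integers put $e_v(w)=\prod_jH_{k_j}(w_j)$ and $v!=\prod_jk_j!$. Let $N_l$ be the set of the $v$ with $\sum_jk_j=l$. Let $G\in L_2(\mathbb R^{m+n},\gamma_{m+n})$ with $\int G\,d\gamma_{m+n}=0$, let $C_v=\int Ge_v\,d\gamma_{m+n}$ be its Hermite coefficients, and let $\kappa\ge1$ be its Hermite rank, that is, the least $l\ge1$ such that $C_v\ne0$ for some $v\in N_l$. Let $0<\alpha<d/\kappa$ and $\beta>d$, let $L_1,L_2$ be slowly varying at infinity, and let $\eta(x)=(\eta_1(x),\dots,\eta_{m+n}(x))$, $x\in\mathbb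 R^d$, be a measurable zero-mean homogeneous isotropic Gaussian vector random field with independent components of unit variance such that, for $x\ne y$, $\mathbf{Cov}(\eta_j(x),\eta_j(y))=\|x-y\|^{-\beta}L_1(\|x-y\|)$ for $j\le m$ and $\mathbf{Cov}(\eta_j(x),\eta_j(y))=\|x-y\|^{-\alpha}L_2(\|x-y\|)$ for $m<j\le m+n$. Suppose that there is a $v\in N_\kappa$ with $C_v\neq0$ and $\sum_{j=m+1}^{m+n}k_j=\kappa$. Let $N_+=\{v\in N_l:\ l\ge\kappa,\ C_v\ne0\}$, let $\gamma$ be the minimum over $v\in N_+$ of $\beta\sum_{j\le m}k_j+\alpha\sum_{j>m}k_j$, and let $N_\kappa^*$ be the set of the $v\in N_+\cap N_\kappa$ at which this minimum is attained. Define $$K_r=\int_{\Delta(r)}G(\eta(x))\,dx,\qquad K_{r,\kappa}=\sum_{v\in N_\kappa}\frac{C_v}{v!}\int_{\Delta(r)}e_v(\eta(x))\,dx,\qquad K^*_{r,\kappa}=\sum_{v\in N^*_\kappa}\frac{C_v}{v!}\int_{\Delta(r)}e_v(\eta(x))\,dx .$$ Then for every $r>0$ the integrals converge absolutely with probability $1$,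 and the three random variables have finite and positive variances. If, as $r\to\infty$, a limit distribution exists for at least one of $K_r/\sqrt{\mathbf{Var}(K_r)}$ and $K_{r,\kappa}/\sqrt{\mathbf{Var}(K_{r,\kappa})}$, then the limit distribution of the other one exists as well, and the two coincide. Likewise, $K_{r,\kappa}/\sqrt{\mathbf{Var}(K_{r,\kappa})}$ and $K^*_{r,\kappa}/\sqrt{\mathbf{Var}(K^*_{r,\kappa})}$ have the same limit distribution, whenever it exists for one of them. Moreover, $$\mathbf{Var}(K_r)\sim\mathbf{Var}(K_{r,\kappa})\sim\mathbf{Var}(K^*_{r,\kappa}),\qquad r\to\infty .$$ -/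

import Mathlib

open MeasureTheory ProbabilityTheory Filter Topology
open scoped Pointwise Nat

noncomputable section

namespace StrongWeak

/-- A measurable function `L : (0,∞) → (0,∞)` that is slowly varying at infinity. Only the values of `L` on
`(0,∞)` matter. -/
structure SlowlyVarying (L : ℝ → ℝ) : Prop where
  measurable : Measurable (fun r : Set.Ioi (0 : ℝ) => L r)
  pos : ∀ r : ℝ, 0 < r → 0 < L r
  tendsto : ∀ t : ℝ, 0 < t → Tendsto (fun r : ℝ => L (t * r) / L r) atTop (𝓝 1)

/-- The observation window: a Jordan-measurable compact connected set with the origin in its interior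
(so that its Lebesgue measure is positive). -/
structure IsWindow {d : ℕ} (Δ : Set (EuclideanSpace ℝ (Fin d))) : Prop where
  isCompact : IsCompact Δ
  isConnected : IsConnected Δ
  jordan : volume (frontier Δ) = 0
  zero_mem : (0 : EuclideanSpace ℝ (Fin d)) ∈ interior Δ

/-- The covariance matrix `B(x)`: `B(0)` is the unit matrix and, for `x ≠ 0`, `B(x)` is diagonal with entries
`‖x‖^(-β) L₁(‖x‖)` (the first `m` components) and `‖x‖^(-α) L₂(‖x‖)` (the last `n` components). -/
def covMatrix {d : ℕ} (m n : ℕ) (α β : ℝ) (L₁ L₂ : ℝ → ℝ) (x : EuclideanSpace ℝ (Fin d)) :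
    Matrix (Fin m ⊕ Fin n) (Fin m ⊕ Fin n) ℝ :=
  open Classical in
  if x = 0 then 1
  else Matrix.diagonal
    (Sum.elim (fun _ => ‖x‖ ^ (-β) * L₁ ‖x‖) (fun _ => ‖x‖ ^ (-α) * L₂ ‖x‖))

/-- A measurable zero-mean homogeneous isotropic Gaussian vector random field on `ℝ^d` with independent components,
indexed by `Fin m ⊕ Fin n`, and covariance matrix `covMatrix`. -/
structure IsStrongWeakField {d m n : ℕ} {Ω : Type*} [MeasurableSpace Ω] (P : Measure Ω)
    (α β : ℝ) (L₁ L₂ : ℝ → ℝ)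
    (η : EuclideanSpace ℝ (Fin d) → Ω → (Fin m ⊕ Fin n → ℝ)) : Prop where
  measurable : Measurable (fun p : EuclideanSpace ℝ (Fin d) × Ω => η p.1 p.2)
  gaussian : IsGaussianProcess η P
  indep : iIndepFun (fun (j : Fin m ⊕ Fin n) (ω : Ω) (x : EuclideanSpace ℝ (Fin d)) => η x ω j) P
  mean_zero : ∀ x j, ∫ ω, η x ω j ∂P = 0
  cov_eq : ∀ x y i j,
    covariance (fun ω => η x ω i) (fun ω => η y ω j) P = covMatrix m n α β L₁ L₂ (x - y) i j

section Hermite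

variable {ι : Type*} [Fintype ι]

/-- The standard Gaussian measure on `ℝ^ι`, with density `∏ j, exp (-(w j)^2 / 2) / √(2π)`. -/
def stdGauss (ι : Type*) [Fintype ι] : Measure (ι → ℝ) :=
  Measure.pi fun _ => gaussianReal 0 1

/-- `e_v(w) = ∏ j, H_{v j}(w j)`, with the (probabilists') Hermite polynomials. -/
def hermiteProd (v : ι → ℕ) (w : ι → ℝ) : ℝ :=
  ∏ j, Polynomial.aeval (w j) (Polynomial.hermite (v j))

/-- The Hermite coefficient `C_v` of `G`. -/
def hermiteCoeff (G : (ι → ℝ) → ℝ) (v : ι → ℕ) : ℝ :=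
  ∫ w, G w * hermiteProd v w ∂(stdGauss ι)

/-- `v! = ∏ j, (v j)!`. -/
def multiFactorial (v : ι → ℕ) : ℕ := ∏ j, (v j)!

/-- `N_k`: the multi-indices of order `k`. -/
def multiIndices (ι : Type*) [Fintype ι] (k : ℕ) : Finset (ι → ℕ) :=
  open Classical in Finset.piAntidiag Finset.univ k

theorem mem_multiIndices {k : ℕ} {v : ι → ℕ} : v ∈ multiIndices ι k ↔ ∑ j, v j = k := by
  simp [multiIndices]

/-- `κ` is the Hermite rank of `G`: the least `k ≥ 1` such that some coefficient of order `k` does not vanish. -/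
def IsHermiteRank (G : (ι → ℝ) → ℝ) (κ : ℕ) : Prop :=
  IsLeast {k : ℕ | 1 ≤ k ∧ ∃ v ∈ multiIndices ι k, hermiteCoeff G v ≠ 0} κ

/-- `N₊`: the multi-indices of order at least `κ` whose coefficient does not vanish. -/
def Nplus (G : (ι → ℝ) → ℝ) (κ : ℕ) : Set (ι → ℕ) :=
  {v | hermiteCoeff G v ≠ 0 ∧ ∃ l, κ ≤ l ∧ v ∈ multiIndices ι l}

end Hermite

section Functionals

variable {d m n : ℕ} {Ω : Type*}

/-- The decay exponent `β ∑_{j ≤ m} k_j + α ∑_{j > m} k_j` of a multi-index. -/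
def weight (α β : ℝ) (v : Fin m ⊕ Fin n → ℕ) : ℝ :=
  β * ∑ j : Fin m, (v (Sum.inl j) : ℝ) + α * ∑ j : Fin n, (v (Sum.inr j) : ℝ)

/-- `γ`: the minimal decay exponent over `N₊`. -/
def minWeight (G : (Fin m ⊕ Fin n → ℝ) → ℝ) (κ : ℕ) (α β : ℝ) : ℝ :=
  sInf (weight α β '' Nplus G κ)

/-- `N*_l`: the elements of `N₊` of order `l` that have the minimal decay exponent. -/
def Nstar (G : (Fin m ⊕ Fin n → ℝ) → ℝ) (κ : ℕ) (α β : ℝ) (l : ℕ) : Finset (Fin m ⊕ Fin n → ℕ) :=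
  open Classical in
  (multiIndices (Fin m ⊕ Fin n) l).filter
    (fun v => v ∈ Nplus G κ ∧ weight α β v = minWeight G κ α β)

/-- `K_r = ∫_{Δ(r)} G(η(x)) dx`, where `Δ(r) = r • Δ`. -/
def K (Δ : Set (EuclideanSpace ℝ (Fin d))) (G : (Fin m ⊕ Fin n → ℝ) → ℝ)
    (η : EuclideanSpace ℝ (Fin d) → Ω → (Fin m ⊕ Fin n → ℝ)) (r : ℝ) (ω : Ω) : ℝ :=
  ∫ x in r • Δ, G (η x ω)

/-- The Hermite component `∑_{v ∈ S} (C_v / v!) ∫_{Δ(r)} e_v(η(x)) dx` over a finite set `S` of multi-indices. -/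
def hermiteSum (Δ : Set (EuclideanSpace ℝ (Fin d))) (G : (Fin m ⊕ Fin n → ℝ) → ℝ)
    (η : EuclideanSpace ℝ (Fin d) → Ω → (Fin m ⊕ Fin n → ℝ))
    (S : Finset (Fin m ⊕ Fin n → ℕ)) (r : ℝ) (ω : Ω) : ℝ :=
  ∑ v ∈ S, hermiteCoeff G v / (multiFactorial v : ℝ) * ∫ x in r • Δ, hermiteProd v (η x ω)

/-- `K_{r,l}`: the sum over all multi-indices of order `l`. -/
def Krank (Δ : Set (EuclideanSpace ℝ (Fin d))) (G : (Fin m ⊕ Fin n → ℝ) → ℝ)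
    (η : EuclideanSpace ℝ (Fin d) → Ω → (Fin m ⊕ Fin n → ℝ)) (l : ℕ) (r : ℝ) (ω : Ω) : ℝ :=
  hermiteSum Δ G η (multiIndices (Fin m ⊕ Fin n) l) r ω

/-- `K*_{r,l}`: the sum over `N*_l`. -/
def Kstar (Δ : Set (EuclideanSpace ℝ (Fin d))) (G : (Fin m ⊕ Fin n → ℝ) → ℝ)
    (η : EuclideanSpace ℝ (Fin d) → Ω → (Fin m ⊕ Fin n → ℝ))
    (κ : ℕ) (α β : ℝ) (l : ℕ) (r : ℝ) (ω : Ω) : ℝ :=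
  hermiteSum Δ G η (Nstar G κ α β l) r ω

/-- The normalized family `X_r / √Var(X_r)` converges in distribution to `ν` as `r → ∞`. -/
def HasLimitLaw [MeasurableSpace Ω] (P : Measure Ω) [IsProbabilityMeasure P] (X : ℝ → Ω → ℝ)
    (ν : Measure ℝ) [IsProbabilityMeasure ν] : Prop :=
  TendstoInDistribution (fun (r : ℝ) (ω : Ω) => X r ω / √(variance (X r) P)) atTop
    (id : ℝ → ℝ) (fun _ => P) ν

end Functionals

end StrongWeak

end

open StrongWeak

/-! Write `ρ₁(z) = ‖z‖^(-β) L₁(‖z‖)` and `ρ₂(z) = ‖z‖^(-α) L₂(‖z‖)`, and for a multi-index `v` let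
`a` and `b` be its total degrees in the first `m` and the last `n` variables. For jointly Gaussian
standard pairs, Hermite polynomials of different degrees are uncorrelated and those of degree `k`
have covariance `k! ρ^k` (`integral_realHermite_mul_realHermite`). By completeness of the Hermite
products, the second moment of `K_r` is therefore the sum over `v` of `C_v²/v!` times the double
integral of `ρ₁^a ρ₂^b` over the window (`hasSum_integral_fieldIntegral_sq`); all terms are
nonnegative.

Since `α < β`, the minimal exponent is `ακ`, and `N*_κ` consists of the `v` with `C_v ≠ 0`, `a = 0`,
`b = κ` (`mem_Nstar_iff`). These all carry the same double integral `A(r)` of `ρ₂^κ`. Any other `v`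
with `C_v ≠ 0` has `a ≥ 1` or `b ≥ κ + 1`. As correlations lie in `(0,1]`, its kernel is at most `ρ₁
+ ρ₂^(κ+1)`, which is `o(ρ₂^κ)` at infinity (`exists_corr_bounds`). Pairs of points at bounded
distance contribute only `O(r^d)`, whereas `A(r)/r^d → ∞` because `ακ < d` (`tendsto_window_ratio`).

Hence both `K_r` and `K_{r,κ}` differ from `K*_{r,κ}` by a quantity negligible in relative mean
square. This gives equivalent variances and, by Slutsky's theorem, equal limit laws
(`isEquivalent_and_hasLimitLaw_iff`). The exact asymptotics of `A(r)` are not needed, so power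
bounds on the slowly varying factors suffice. -/

namespace StrongWeak

/-! ### Power bounds for slowly varying functions. -/

section SlowVariation

/-- Pointwise convergence of the increments becomes a uniform bound by averaging: for most `s` in
`[u, 2]`, `f (x + s)` is close to both `f x` and `f (x + u)`. Truncation at `1` permits dominated
convergence without any integrability of `f`. -/
theorem exists_forall_abs_add_sub_le {f : ℝ → ℝ} (hf : Measurable f)
    (h : ∀ u, Tendsto (fun x => f (x + u) - f x) atTop (𝓝 0)) :
    ∃ X, ∀ x, X ≤ x → ∀ u ∈ Set.Icc (0 : ℝ) 1, |f (x + u) - f x| ≤ 1 / 2 := by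
  have key : Tendsto (fun x => ∫ s in (0 : ℝ)..2, min 1 |f (x + s) - f x|) atTop
      (𝓝 (∫ _ in (0 : ℝ)..2, (0 : ℝ))) := by
    apply intervalIntegral.tendsto_integral_filter_of_dominated_convergence (fun _ => (1 : ℝ))
    · exact Eventually.of_forall fun x => (measurable_const.min ((hf.comp (measurable_const_add x)).sub_const
      (f x)).norm).aestronglyMeasurable
    · refine Eventually.of_forall fun x => Eventually.of_forall fun s _ => ?_
      rw [Real.norm_of_nonneg (by positivity)]
      exact min_le_left _ _
    · exact intervalIntegrable_const
    · refine Eventually.of_forall fun s _ => ?_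
      have := (h s).abs
      simpa using (tendsto_const_nhds (x := (1 : ℝ))).min this
  simp only [intervalIntegral.integral_zero] at key
  -- Two such integrals add up to less than `1/4`, while `[u, 2]` has length at least `1`; so the
  -- truncated increment is at most `1/4` and the truncation is inactive.
  obtain ⟨X, hX⟩ := eventually_atTop.1 (key.eventually_lt_const (show (0 : ℝ) < 1 / 8 by norm_num))
  have int (a b c x : ℝ) : IntervalIntegrable (fun s => min 1 |f (c + s) - f x|) volume a b := by
    refine (intervalIntegrable_const (c := (1 : ℝ))).mono_fun' (measurable_const.min
      ((hf.comp (measurable_const_add c)).sub_const (f x)).norm).aestronglyMeasurable ?_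
    refine Eventually.of_forall fun s => ?_
    simp only
    rw [Real.norm_of_nonneg (by positivity)]
    exact min_le_left _ _
  refine ⟨X, fun x hx u hu => ?_⟩
  have h1 := hX x hx
  have h2 := hX (x + u) (by linarith [hu.1])
  have h1' : ∫ s in u..2, min 1 |f (x + s) - f x| ≤ ∫ s in (0 : ℝ)..2, min 1 |f (x + s) - f x| := by
    apply intervalIntegral.integral_mono_interval hu.1 (by linarith [hu.2]) le_rfl
    · exact Eventually.of_forall fun s => by simp only [Pi.zero_apply]; positivity
    · exact int _ _ _ _
  have h2' : ∫ s in u..2, min 1 |f (x + s) - f (x + u)| ≤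
      ∫ s in (0 : ℝ)..2, min 1 |f (x + u + s) - f (x + u)| := by
    have e : ∫ s in u..2, min 1 |f (x + s) - f (x + u)| =
        ∫ s in (0 : ℝ)..2 - u, min 1 |f (x + u + s) - f (x + u)| := by
      have := intervalIntegral.integral_comp_add_left (a := 0) (b := 2 - u)
        (fun s => min 1 |f (x + s) - f (x + u)|) u
      simp only [add_zero, add_sub_cancel] at this
      rw [← this]
      simp only [add_assoc]
    rw [e]
    apply intervalIntegral.integral_mono_interval le_rfl (by linarith [hu.2]) (by linarith [hu.1])
    · exact Eventually.of_forall fun s => by simp only [Pi.zero_apply]; positivity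
    · exact int _ _ _ _
  have h3 : ∫ _ in u..2, min 1 |f (x + u) - f x| ≤
      ∫ s in u..2, (min 1 |f (x + s) - f x| + min 1 |f (x + s) - f (x + u)|) := by
    apply intervalIntegral.integral_mono_on (by linarith [hu.2]) intervalIntegrable_const
      ((int _ _ _ _).add (int _ _ _ _))
    intro s _
    have : |f (x + u) - f x| ≤ |f (x + s) - f x| + |f (x + s) - f (x + u)| := by
      rw [abs_sub_comm (f (x + s)) (f (x + u)), add_comm |f (x + s) - f x|]
      exact abs_sub_le _ _ _
    have a1 := abs_nonneg (f (x + s) - f x)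
    have a2 := abs_nonneg (f (x + s) - f (x + u))
    simp only [min_def]
    split_ifs <;> linarith
  rw [intervalIntegral.integral_add (int _ _ _ _) (int _ _ _ _), intervalIntegral.integral_const,
    smul_eq_mul] at h3
  have h4 : min 1 |f (x + u) - f x| ≤ 1 / 4 := by
    have : 0 ≤ min 1 |f (x + u) - f x| := by positivity
    nlinarith [hu.2]
  rcases min_le_iff.1 h4 with h5 | h5 <;> linarith

/-- The uniform bound, telescoped over unit steps, gives linear growth with arbitrarily small slope.
-/
theorem eventually_abs_le_mul {f : ℝ → ℝ} (hf : Measurable f)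
    (h : ∀ u, Tendsto (fun x => f (x + u) - f x) atTop (𝓝 0)) {ε : ℝ} (hε : 0 < ε) :
    ∀ᶠ x in atTop, |f x| ≤ ε * x := by
  -- Rescaling by `ε⁻¹` turns the fixed bound `1/2` into `ε/2`.
  obtain ⟨X, hX⟩ := exists_forall_abs_add_sub_le (f := fun x => ε⁻¹ * f x) (by fun_prop)
    (fun u => by simpa [mul_sub] using (h u).const_mul ε⁻¹)
  have hX' : ∀ x, X ≤ x → ∀ u ∈ Set.Icc (0 : ℝ) 1, |f (x + u) - f x| ≤ ε / 2 := by
    intro x hx u hu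
    have := hX x hx u hu
    rw [← mul_sub, abs_mul, abs_of_pos (inv_pos.2 hε), inv_mul_le_iff₀ hε] at this
    linarith
  have ind : ∀ k : ℕ, ∀ x, X ≤ x → x ≤ X + k → |f x - f X| ≤ ε / 2 * k := by
    intro k
    induction k with
    | zero =>
      intro x h1 h2
      obtain rfl : x = X := le_antisymm (by simpa using h2) h1
      simp
    | succ k ih =>
      intro x h1 h2
      push_cast at h2 ⊢
      rcases le_total x (X + k) with h3 | h3
      · linarith [ih x h1 h3]
      · have a := ih (X + k) (by linarith [(Nat.cast_nonneg k : (0 : ℝ) ≤ k)]) le_rfl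
        have b := hX' (X + k) (by linarith [(Nat.cast_nonneg k : (0 : ℝ) ≤ k)]) (x - (X + k))
          ⟨by linarith, by linarith⟩
        rw [add_sub_cancel] at b
        have := abs_sub_le (f x) (f (X + k)) (f X)
        linarith
  -- The unused half of the slope absorbs `|f X|` and the rounding up of the number of steps.
  have lim : ∀ᶠ x : ℝ in atTop, |f X| + ε / 2 * (1 - X) ≤ ε / 2 * x :=
    (tendsto_id.const_mul_atTop (half_pos hε)).eventually_ge_atTop _
  filter_upwards [lim, eventually_ge_atTop X] with x hx1 hx2
  have a := ind ⌈x - X⌉₊ x hx2 (by linarith [Nat.le_ceil (x - X)])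
  have b := (Nat.ceil_lt_add_one (sub_nonneg.2 hx2)).le
  have c := abs_sub_le (f x) (f X) 0
  simp only [sub_zero] at c
  have := mul_le_mul_of_nonneg_left b (half_pos hε).le
  linarith

/-- In logarithmic coordinates, `f x = log (L (exp x))`, slow variation says that the increments of
`f` vanish at infinity; sublinear growth of `f` is then a power bound on `L`. -/
theorem SlowlyVarying.eventually_rpow_le {L : ℝ → ℝ} (hL : SlowlyVarying L) {ε : ℝ} (hε : 0 < ε) :
    ∀ᶠ t in atTop, t ^ (-ε) ≤ L t ∧ L t ≤ t ^ ε := by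
  have hm : Measurable fun x => Real.log (L (Real.exp x)) := by
    apply Real.measurable_log.comp
    exact hL.measurable.comp
      (g := fun r : Set.Ioi (0 : ℝ) => L r) (f := fun x : ℝ => ⟨Real.exp x, Real.exp_pos x⟩)
      (Real.measurable_exp.subtype_mk)
  have hlim : ∀ u, Tendsto (fun x => Real.log (L (Real.exp (x + u))) - Real.log (L (Real.exp x)))
      atTop (𝓝 0) := by
    intro u
    have := ((hL.tendsto (Real.exp u) (Real.exp_pos u)).comp Real.tendsto_exp_atTop).log one_ne_zero
    simp only [Real.log_one] at this
    refine this.congr fun x => ?_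
    simp only [Function.comp]
    rw [Real.log_div (hL.pos _ (by positivity)).ne' (hL.pos _ (by positivity)).ne', Real.exp_add,
      mul_comm]
  filter_upwards [Real.tendsto_log_atTop.eventually (eventually_abs_le_mul hm hlim hε),
    eventually_gt_atTop 0] with t ht h0
  rw [Real.exp_log h0, abs_le] at ht
  rw [← Real.log_le_log_iff (by positivity) (hL.pos t h0),
    ← Real.log_le_log_iff (hL.pos t h0) (by positivity), Real.log_rpow h0, Real.log_rpow h0]
  exact ⟨by linarith [ht.1], ht.2⟩

end SlowVariation

/-! ### The algebra of random variables with all moments. -/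

section Moments

open scoped ENNReal

variable {Ω : Type*} [MeasurableSpace Ω] {P : Measure Ω}

/-- All moments of `f` are finite. -/
def HasMoments (f : Ω → ℝ) (P : Measure Ω) : Prop := ∀ q : ℝ≥0∞, q ≠ ∞ → MemLp f q P

theorem HasMoments.const [IsFiniteMeasure P] (c : ℝ) : HasMoments (fun _ => c) P :=
  fun _ _ => memLp_const c

theorem HasMoments.add {f g : Ω → ℝ} (hf : HasMoments f P) (hg : HasMoments g P) :
    HasMoments (fun ω => f ω + g ω) P := fun q hq => (hf q hq).add (hg q hq)

/-- Hölder with exponents `2q, 2q`: the doubling of the exponent is why every finite one is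
required. -/
theorem HasMoments.mul {f g : Ω → ℝ} (hf : HasMoments f P) (hg : HasMoments g P) :
    HasMoments (fun ω => f ω * g ω) P := by
  intro q hq
  have h2 : 2 * q ≠ ∞ := ENNReal.mul_ne_top (by norm_num) hq
  have : ENNReal.HolderTriple (2 * q) (2 * q) q := ⟨by
    rw [ENNReal.mul_inv (by simp) (by simp), ← add_mul, ENNReal.inv_two_add_inv_two, one_mul]⟩
  exact (hg (2 * q) h2).mul (hf (2 * q) h2)

theorem HasMoments.prod [IsFiniteMeasure P] {ι : Type*} (s : Finset ι) {f : ι → Ω → ℝ}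
    (hf : ∀ i ∈ s, HasMoments (f i) P) : HasMoments (fun ω => ∏ i ∈ s, f i ω) P := by
  classical
  induction s using Finset.induction_on with
  | empty => simpa using HasMoments.const 1
  | insert i s hi ih =>
    simp only [Finset.prod_insert hi]
    exact (hf i (by simp)).mul (ih fun j hj => hf j (by simp [hj]))

theorem HasMoments.eval [IsFiniteMeasure P] {f : Ω → ℝ} (hf : HasMoments f P) (p : Polynomial ℝ) :
    HasMoments (fun ω => p.eval (f ω)) P := by
  induction p using Polynomial.induction_on' with
  | add p q hp hq => simpa using hp.add hq
  | monomial k a =>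
    simp only [Polynomial.eval_monomial]
    refine (HasMoments.const a).mul ?_
    simpa using HasMoments.prod (Finset.range k) (f := fun _ => f) fun _ _ => hf

theorem HasMoments.integrable [IsFiniteMeasure P] {f : Ω → ℝ} (hf : HasMoments f P) :
    Integrable f P := memLp_one_iff_integrable.1 (hf 1 (by simp))

theorem HasMoments.comp {Ω' : Type*} [MeasurableSpace Ω'] {Q : Measure Ω'} {X : Ω' → Ω}
    (hX : AEMeasurable X Q) {f : Ω → ℝ} (hf : HasMoments f (Q.map X)) :
    HasMoments (fun ω => f (X ω)) Q := fun q hq => (hf q hq).comp_of_map hX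

theorem hasMoments_of_hasGaussianLaw {X : Ω → ℝ} (hX : HasGaussianLaw X P) : HasMoments X P :=
  fun _ hq => hX.memLp hq

theorem hasMoments_id_gaussianReal : HasMoments (fun x => x) (gaussianReal 0 1) :=
  fun q hq => memLp_id_gaussianReal' q hq

end Moments

/-! ### Gaussian integration by parts. -/

section Stein

/-- Integration by parts against the density `φ`, which satisfies `φ' = -xφ`. -/
theorem integral_mul_eval_gaussianReal (p : Polynomial ℝ) :
    ∫ x, x * p.eval x ∂(gaussianReal 0 1) = ∫ x, p.derivative.eval x ∂(gaussianReal 0 1) := by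
  have int (q : Polynomial ℝ) : Integrable (fun x => q.eval x * gaussianPDFReal 0 1 x) := by
    have := (hasMoments_id_gaussianReal.eval q).integrable
    rw [gaussianReal_of_var_ne_zero _ one_ne_zero,
      integrable_withDensity_iff_integrable_smul' (measurable_gaussianPDF 0 1) (by simp [gaussianPDF])]
      at this
    simpa [mul_comm] using this
  have hd (x : ℝ) : HasDerivAt (gaussianPDFReal 0 1) (-(x * gaussianPDFReal 0 1 x)) x := by
    have h1 : HasDerivAt (fun y : ℝ => -(y - 0) ^ 2 / (2 * ((1 : NNReal) : ℝ))) (-x) x := by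
      have := (((hasDerivAt_id x).sub_const 0).pow 2).neg.div_const (2 * ((1 : NNReal) : ℝ))
      refine this.congr_deriv ?_
      simp
      ring
    have := h1.exp.const_mul (√(2 * Real.pi * ((1 : NNReal) : ℝ)))⁻¹
    refine this.congr_deriv ?_
    simp only [gaussianPDFReal]
    ring
  have key := integral_mul_deriv_eq_deriv_mul_of_integrable (u := fun x => p.eval x)
    (v := gaussianPDFReal 0 1) (u' := fun x => p.derivative.eval x)
    (v' := fun x => -(x * gaussianPDFReal 0 1 x)) (fun x _ => p.hasDerivAt x) (fun x _ => hd x)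
    (by
      have := (int (p * Polynomial.X)).neg
      refine this.congr (Eventually.of_forall fun x => ?_)
      simp
      ring)
    (int _) (int _)
  rw [integral_gaussianReal_eq_integral_smul one_ne_zero,
    integral_gaussianReal_eq_integral_smul one_ne_zero]
  simp only [smul_eq_mul]
  have e1 : ∫ x, gaussianPDFReal 0 1 x * (x * p.eval x) =
      - ∫ x, p.eval x * -(x * gaussianPDFReal 0 1 x) := by
    rw [← integral_neg]
    exact integral_congr_ae (Eventually.of_forall fun x => by simp only; ring)
  rw [e1, key, neg_neg]
  exact integral_congr_ae (Eventually.of_forall fun x => by simp only; ring)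

variable {Ω : Type*} [MeasurableSpace Ω] {P : Measure Ω}

theorem map_eq_gaussianReal_of_moments {X : Ω → ℝ} (hX : HasGaussianLaw X P) (h0 : ∫ ω, X ω ∂P = 0)
    (h1 : variance X P = 1) : P.map X = gaussianReal 0 1 := by
  rw [hX.map_eq_gaussianReal, h0, h1]
  simp

variable [IsProbabilityMeasure P]

/-- Gaussian integration by parts for polynomials in a jointly Gaussian pair. -/
theorem integral_mul_eval_mul_eval {X Y : Ω → ℝ} (hXY : HasGaussianLaw (fun ω => (X ω, Y ω)) P)
    (hX0 : ∫ ω, X ω ∂P = 0) (hX1 : variance X P = 1) (p q : Polynomial ℝ) :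
    ∫ ω, X ω * p.eval (X ω) * q.eval (Y ω) ∂P =
      ∫ ω, p.derivative.eval (X ω) * q.eval (Y ω) ∂P +
        covariance X Y P * ∫ ω, p.eval (X ω) * q.derivative.eval (Y ω) ∂P := by
  set ρ := covariance X Y P with hρ
  have gX : HasGaussianLaw X P := hXY.fst
  have gY : HasGaussianLaw Y P := hXY.snd
  -- The regression residual of `Y` on `X` is uncorrelated with `X`, hence independent of it by
  -- joint Gaussianity. The law of `(X, W)` is then a product, and `X` can be integrated out with
  -- `W` frozen.
  set W : Ω → ℝ := fun ω => Y ω - ρ * X ω with hW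
  have gXW : HasGaussianLaw (fun ω => (X ω, W ω)) P := by
    have := hXY.map_fun ((ContinuousLinearMap.fst ℝ ℝ ℝ).prod
      (ContinuousLinearMap.snd ℝ ℝ ℝ - ρ • ContinuousLinearMap.fst ℝ ℝ ℝ))
    simpa using this
  have gW : HasGaussianLaw W P := gXW.snd
  have hcov : covariance X W P = 0 := by
    have : W = Y - fun ω => ρ * X ω := rfl
    rw [this, covariance_sub_right gX.memLp_two gY.memLp_two (gX.memLp_two.const_mul ρ),
      covariance_const_mul_right, covariance_self gX.aemeasurable, hX1]
    simp [hρ]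
  have hind : IndepFun X W P := gXW.indepFun_of_covariance_eq_zero hcov
  have hmap := (indepFun_iff_map_prod_eq_prod_map_map gX.aemeasurable gW.aemeasurable).1 hind
  rw [map_eq_gaussianReal_of_moments gX hX0 hX1] at hmap
  have hYW : ∀ ω, Y ω = ρ * X ω + W ω := fun ω => by simp [hW]
  have mXW : AEMeasurable (fun ω => (X ω, W ω)) P := gXW.aemeasurable
  have : IsProbabilityMeasure (P.map W) := Measure.isProbabilityMeasure_map gW.aemeasurable
  have mX : HasMoments X P := hasMoments_of_hasGaussianLaw gX
  have mY : HasMoments Y P := hasMoments_of_hasGaussianLaw gY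
  have trans (a b : Polynomial ℝ) : Integrable
      (fun z : ℝ × ℝ => a.eval z.1 * b.eval (ρ * z.1 + z.2)) ((gaussianReal 0 1).prod (P.map W)) ∧
      ∫ ω, a.eval (X ω) * b.eval (Y ω) ∂P =
        ∫ w, ∫ x, a.eval x * b.eval (ρ * x + w) ∂(gaussianReal 0 1) ∂(P.map W) := by
    have meas : AEStronglyMeasurable (fun z : ℝ × ℝ => a.eval z.1 * b.eval (ρ * z.1 + z.2))
        (P.map fun ω => (X ω, W ω)) := by
      refine Continuous.aestronglyMeasurable ?_
      exact (a.continuous.comp continuous_fst).mul (b.continuous.comp (by fun_prop))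
    have i : Integrable
        (fun z : ℝ × ℝ => a.eval z.1 * b.eval (ρ * z.1 + z.2)) ((gaussianReal 0 1).prod (P.map W)) := by
      rw [← hmap, integrable_map_measure meas mXW]
      have := ((mX.eval a).mul (mY.eval b)).integrable
      simpa only [Function.comp_def, ← hYW] using this
    refine ⟨i, ?_⟩
    rw [← integral_prod_symm _ i, ← hmap, integral_map mXW meas]
    simp only [← hYW]
  have t1 := trans (Polynomial.X * p) q
  have t2 := trans p.derivative q
  have t3 := trans p q.derivative
  simp only [Polynomial.eval_mul, Polynomial.eval_X] at t1
  rw [t1.2, t2.2, t3.2, ← integral_const_mul, ← integral_add t2.1.integral_prod_right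
    (t3.1.integral_prod_right.const_mul ρ)]
  refine integral_congr_ae (Eventually.of_forall fun w => ?_)
  -- For fixed `w`, the product rule on `p(x) q(ρx + w)` yields both terms; the chain rule supplies
  -- the covariance `ρ`.
  have s := integral_mul_eval_gaussianReal (p * q.comp (Polynomial.C ρ * Polynomial.X + Polynomial.C w))
  have m (a b : Polynomial ℝ) : Integrable (fun x => a.eval x * b.eval (ρ * x + w)) (gaussianReal 0 1) := by
    have := (hasMoments_id_gaussianReal.eval
      (a * b.comp (Polynomial.C ρ * Polynomial.X + Polynomial.C w))).integrable
    simpa using this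
  simp only
  rw [← integral_const_mul, ← integral_add (m _ _) ((m _ _).const_mul ρ)]
  convert s using 1
  · simp [mul_assoc]
  · congr 1
    ext x
    simp [Polynomial.derivative_comp]
    ring

end Stein

/-! ### Covariances of Hermite polynomials of Gaussian variables. -/

section HermiteMoments

/-- The Hermite polynomial with real coefficients. -/
noncomputable def realHermite (k : ℕ) : Polynomial ℝ :=
  (Polynomial.hermite k).map (Int.castRingHom ℝ)

theorem aeval_hermite (k : ℕ) (x : ℝ) :
    Polynomial.aeval x (Polynomial.hermite k) = (realHermite k).eval x := by
  rw [realHermite, Polynomial.eval_map, Polynomial.aeval_def]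
  rfl

theorem realHermite_zero : realHermite 0 = 1 := by simp [realHermite]

theorem realHermite_succ (k : ℕ) :
    realHermite (k + 1) = Polynomial.X * realHermite k - (realHermite k).derivative := by
  simp [realHermite, Polynomial.hermite_succ, Polynomial.derivative_map]

theorem realHermite_monic (k : ℕ) : (realHermite k).Monic :=
  (Polynomial.hermite_monic k).map _

theorem natDegree_realHermite (k : ℕ) : (realHermite k).natDegree = k := by
  rw [realHermite, (Polynomial.hermite_monic k).natDegree_map, Polynomial.natDegree_hermite]

theorem derivative_realHermite_succ (k : ℕ) :
    (realHermite (k + 1)).derivative = (k + 1 : Polynomial ℝ) * realHermite k := by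
  induction k with
  | zero => simp [realHermite_succ, realHermite_zero]
  | succ k ih =>
    rw [realHermite_succ (k + 1), Polynomial.derivative_sub, Polynomial.derivative_mul, ih,
      Polynomial.derivative_X]
    have : Polynomial.derivative ((k + 1 : Polynomial ℝ) * realHermite k) =
        (k + 1 : Polynomial ℝ) * (realHermite k).derivative := by
      have h : (k + 1 : Polynomial ℝ) = ((k + 1 : ℕ) : Polynomial ℝ) := by push_cast; rfl
      rw [h, Polynomial.derivative_natCast_mul]
    rw [this, realHermite_succ k]
    push_cast
    ring

variable {Ω : Type*} [MeasurableSpace Ω] {P : Measure Ω} [IsProbabilityMeasure P]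

/-- In `H_{k+1} = x H_k - H_k'`, integration by parts cancels the `H_k'` term and leaves `ρ` times
the moment of `H_k(X) H_l'(Y)`. As `H_{l+1}' = (l+1) H_l`, both degrees drop by one at each
induction step. -/
theorem integral_realHermite_mul_realHermite {X Y : Ω → ℝ}
    (hXY : HasGaussianLaw (fun ω => (X ω, Y ω)) P)
    (hX0 : ∫ ω, X ω ∂P = 0) (hX1 : variance X P = 1)
    (hY0 : ∫ ω, Y ω ∂P = 0) (hY1 : variance Y P = 1) (k l : ℕ) :
    ∫ ω, (realHermite k).eval (X ω) * (realHermite l).eval (Y ω) ∂P =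
      if k = l then k ! * covariance X Y P ^ k else 0 := by
  have mX : HasMoments X P := hasMoments_of_hasGaussianLaw hXY.fst
  have mY : HasMoments Y P := hasMoments_of_hasGaussianLaw hXY.snd
  have gYX : HasGaussianLaw (fun ω => (Y ω, X ω)) P := by
    have := hXY.map_fun ((ContinuousLinearMap.snd ℝ ℝ ℝ).prod (ContinuousLinearMap.fst ℝ ℝ ℝ))
    simpa using this
  induction k generalizing l with
  | zero =>
    cases l with
    | zero => simp [realHermite_zero]
    | succ l =>
      -- With the constant on the `X` side, the roles are exchanged: the formula is applied to `Y`
      -- with second polynomial `1`.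
      have := integral_mul_eval_mul_eval gYX hY0 hY1 (realHermite l) 1
      simp only [Polynomial.eval_one, mul_one, Polynomial.derivative_one, Polynomial.eval_zero,
        mul_zero, integral_zero, add_zero] at this
      simp only [realHermite_zero, realHermite_succ, Polynomial.eval_one, one_mul,
        Polynomial.eval_sub, Polynomial.eval_mul, Polynomial.eval_X]
      rw [integral_sub (mY.mul (mY.eval _)).integrable (mY.eval _).integrable, this]
      simp
  | succ k ih =>
    have := integral_mul_eval_mul_eval hXY hX0 hX1 (realHermite k) (realHermite l)
    simp only [realHermite_succ k, Polynomial.eval_sub, Polynomial.eval_mul, Polynomial.eval_X,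
      sub_mul]
    rw [integral_sub ((mX.mul (mX.eval _)).mul (mY.eval _)).integrable
      ((mX.eval _).mul (mY.eval _)).integrable, this, add_sub_cancel_left]
    cases l with
    | zero => simp [realHermite_zero]
    | succ l =>
      have e (ω : Ω) : (realHermite k).eval (X ω) * (realHermite (l + 1)).derivative.eval (Y ω) =
          (l + 1) * ((realHermite k).eval (X ω) * (realHermite l).eval (Y ω)) := by
        rw [derivative_realHermite_succ]
        simp
        ring
      simp only [e]
      rw [integral_const_mul, ih l]
      by_cases h : k = l
      · subst h
        simp [Nat.factorial_succ, pow_succ]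
        ring
      · simp [h]

end HermiteMoments

/-! ### Completeness of the Hermite products and Parseval's identity. -/

section HermiteExpansion

variable {ι : Type*} [Fintype ι]

instance isProbabilityMeasure_stdGauss : IsProbabilityMeasure (stdGauss ι) := by
  unfold stdGauss
  infer_instance

theorem map_eval_stdGauss (j : ι) : (stdGauss ι).map (fun w => w j) = gaussianReal 0 1 :=
  (measurePreserving_eval (fun _ : ι => gaussianReal 0 1) j).map_eq

theorem hasMoments_eval_stdGauss (j : ι) : HasMoments (fun w : ι → ℝ => w j) (stdGauss ι) := by
  refine HasMoments.comp (f := fun x : ℝ => x) (X := fun w : ι → ℝ => w j) (measurable_pi_apply j).aemeasurable ?_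
  rw [map_eval_stdGauss]
  exact hasMoments_id_gaussianReal

theorem hermiteProd_eq (v : ι → ℕ) (w : ι → ℝ) :
    hermiteProd v w = ∏ j, (realHermite (v j)).eval (w j) := by
  simp [hermiteProd, aeval_hermite]

theorem hasMoments_prod_eval (p : ι → Polynomial ℝ) :
    HasMoments (fun w : ι → ℝ => ∏ j, (p j).eval (w j)) (stdGauss ι) :=
  HasMoments.prod _ fun j _ => (hasMoments_eval_stdGauss j).eval (p j)

theorem hasMoments_hermiteProd (v : ι → ℕ) : HasMoments (hermiteProd v) (stdGauss ι) := by
  have := hasMoments_prod_eval fun j => realHermite (v j)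
  simpa only [← hermiteProd_eq] using this

theorem memLp_hermiteProd (v : ι → ℕ) : MemLp (hermiteProd v) 2 (stdGauss ι) :=
  hasMoments_hermiteProd v 2 (by simp)

theorem multiFactorial_pos (v : ι → ℕ) : (0 : ℝ) < multiFactorial v := by
  unfold multiFactorial
  exact_mod_cast Finset.prod_pos fun j _ => Nat.factorial_pos (v j)

theorem integral_hermiteProd_mul_hermiteProd [DecidableEq ι] (v u : ι → ℕ) :
    ∫ w, hermiteProd v w * hermiteProd u w ∂(stdGauss ι) =
      if v = u then (multiFactorial v : ℝ) else 0 := by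
  simp only [hermiteProd_eq, ← Finset.prod_mul_distrib, stdGauss]
  rw [integral_fintype_prod_eq_prod
    (fun j x => (realHermite (v j)).eval x * (realHermite (u j)).eval x)]
  have gid : HasGaussianLaw (fun x : ℝ => x) (gaussianReal 0 1) := IsGaussian.hasGaussianLaw_id
  -- Orthogonality is the covariance formula for the degenerate pair `(x, x)`, with correlation `1`.
  have g : HasGaussianLaw (fun x : ℝ => (x, x)) (gaussianReal 0 1) := by
    have := gid.map_fun ((ContinuousLinearMap.id ℝ ℝ).prod (ContinuousLinearMap.id ℝ ℝ))
    simpa using this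
  have v1 : variance (fun x : ℝ => x) (gaussianReal 0 1) = 1 := by simp
  have m0 : ∫ x, x ∂(gaussianReal 0 1) = 0 := by simp
  have h (k l : ℕ) := integral_realHermite_mul_realHermite g m0 v1 m0 v1 k l
  rw [covariance_self gid.aemeasurable, v1] at h
  simp only [one_pow, mul_one] at h
  simp only [h, multiFactorial]
  split_ifs with hvu
  · subst hvu
    simp
  · obtain ⟨j, hj⟩ := Function.ne_iff.1 hvu
    exact Finset.prod_eq_zero (Finset.mem_univ j) (if_neg hj)

/-- A real polynomial is a linear combination of Hermite polynomials. -/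
theorem exists_eq_sum_realHermite (p : Polynomial ℝ) :
    ∃ (N : ℕ) (c : ℕ → ℝ), p = ∑ k ∈ Finset.range N, Polynomial.C (c k) * realHermite k := by
  have key : ∀ N : ℕ, ∀ p : Polynomial ℝ, p.degree < N →
      ∃ c : ℕ → ℝ, p = ∑ k ∈ Finset.range N, Polynomial.C (c k) * realHermite k := by
    intro N
    induction N with
    | zero =>
      intro p hp
      have : p = 0 := by
        rw [← Polynomial.degree_eq_bot]
        exact Nat.WithBot.lt_zero_iff.1 (by simpa using hp)
      exact ⟨0, by simp [this]⟩
    | succ N ih =>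
      intro p hp
      have hq : (p - Polynomial.C (p.coeff N) * realHermite N).degree < N := by
        rw [Polynomial.degree_lt_iff_coeff_zero]
        intro k hk
        rcases hk.eq_or_lt with rfl | hk
        · have h1 : (realHermite N).coeff N = 1 := by
            have := (realHermite_monic N).coeff_natDegree
            rwa [natDegree_realHermite] at this
          simp [h1]
        · have h1 : p.coeff k = 0 := (Polynomial.degree_lt_iff_coeff_zero p (N + 1)).1 hp k hk
          have h2 : (realHermite N).coeff k = 0 :=
            Polynomial.coeff_eq_zero_of_natDegree_lt (by rwa [natDegree_realHermite])
          simp [h1, h2]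
      obtain ⟨c, hc⟩ := ih _ hq
      refine ⟨fun k => if k = N then p.coeff N else c k, ?_⟩
      simp only [Finset.sum_range_succ, if_true]
      conv_lhs => rw [eq_add_of_sub_eq hc]
      congr 1
      refine Finset.sum_congr rfl fun k hk => ?_
      rw [if_neg (Finset.mem_range.1 hk).ne]
  obtain ⟨c, hc⟩ := key (p.natDegree + 1) p
    (Polynomial.degree_le_natDegree.trans_lt (by exact_mod_cast Nat.lt_succ_self _))
  exact ⟨_, c, hc⟩

theorem integrable_mul_of_memLp {f g : (ι → ℝ) → ℝ} (hf : MemLp f 2 (stdGauss ι))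
    (hg : MemLp g 2 (stdGauss ι)) : Integrable (fun w => f w * g w) (stdGauss ι) :=
  hf.integrable_mul hg

theorem integral_mul_prod_eval_eq_zero {g : (ι → ℝ) → ℝ} (hg : MemLp g 2 (stdGauss ι))
    (h : ∀ v, hermiteCoeff g v = 0) (p : ι → Polynomial ℝ) :
    ∫ w, g w * ∏ j, (p j).eval (w j) ∂(stdGauss ι) = 0 := by
  classical
  choose N c hc using fun j => exists_eq_sum_realHermite (p j)
  have e (w : ι → ℝ) : g w * ∏ j, (p j).eval (w j) =
      ∑ v ∈ Fintype.piFinset fun j => Finset.range (N j),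
        (∏ j, c j (v j)) * (g w * hermiteProd v w) := by
    have : ∀ j, (p j).eval (w j) =
        ∑ k ∈ Finset.range (N j), c j k * (realHermite k).eval (w j) := by
      intro j
      conv_lhs => rw [hc j]
      simp [Polynomial.eval_finsetSum]
    simp only [this]
    rw [Finset.prod_univ_sum, Finset.mul_sum]
    refine Finset.sum_congr rfl fun v _ => ?_
    rw [Finset.prod_mul_distrib, hermiteProd_eq]
    ring
  simp only [e]
  rw [integral_finsetSum _ fun v _ =>
    (integrable_mul_of_memLp hg (memLp_hermiteProd v)).const_mul _]
  refine Finset.sum_eq_zero fun v _ => ?_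
  rw [integral_const_mul]
  have := h v
  unfold hermiteCoeff at this
  rw [this, mul_zero]

/-- The multinomial theorem reduces this to products of polynomials. Powers of linear forms are the
Taylor terms of the characters treated next. -/
theorem integral_mul_linear_pow_eq_zero {g : (ι → ℝ) → ℝ} (hg : MemLp g 2 (stdGauss ι))
    (h : ∀ v, hermiteCoeff g v = 0) (t : ι → ℝ) (k : ℕ) :
    Integrable (fun w => g w * (∑ j, t j * w j) ^ k) (stdGauss ι) ∧
    ∫ w, g w * (∑ j, t j * w j) ^ k ∂(stdGauss ι) = 0 := by
  classical
  have e (w : ι → ℝ) : g w * (∑ j, t j * w j) ^ k =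
      ∑ v ∈ Finset.piAntidiag Finset.univ k, (Nat.multinomial Finset.univ v * ∏ j, t j ^ v j) *
        (g w * ∏ j, (Polynomial.X ^ v j : Polynomial ℝ).eval (w j)) := by
    rw [Finset.sum_pow_eq_sum_piAntidiag, Finset.mul_sum]
    refine Finset.sum_congr rfl fun v _ => ?_
    simp only [mul_pow, Finset.prod_mul_distrib, Polynomial.eval_pow, Polynomial.eval_X]
    ring
  simp only [e]
  have i (v : ι → ℕ) := (integrable_mul_of_memLp hg (hasMoments_prod_eval
    (fun j => (Polynomial.X ^ v j : Polynomial ℝ)) 2 (by simp))).const_mul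
      (Nat.multinomial Finset.univ v * ∏ j, t j ^ v j : ℝ)
  refine ⟨integrable_finsetSum _ fun v _ => i v, ?_⟩
  rw [integral_finsetSum _ fun v _ => i v]
  refine Finset.sum_eq_zero fun v _ => ?_
  rw [integral_const_mul, integral_mul_prod_eval_eq_zero hg h, mul_zero]

theorem memLp_exp_linear (t : ι → ℝ) :
    MemLp (fun w : ι → ℝ => Real.exp (∑ j, t j * w j)) 2 (stdGauss ι) := by
  rw [memLp_two_iff_integrable_sq
    (Continuous.aestronglyMeasurable (by fun_prop))]
  have : (fun w : ι → ℝ => Real.exp (∑ j, t j * w j) ^ 2) =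
      fun w => ∏ j, Real.exp (2 * t j * w j) := by
    ext w
    rw [← Real.exp_sum, ← Real.exp_nat_mul, Finset.mul_sum]
    simp [mul_assoc]
  rw [this]
  exact Integrable.fintype_prod (f := fun j x => Real.exp (2 * t j * x))
    fun j => integrable_exp_mul_gaussianReal _

/-- The exponential is expanded in its Taylor series. The partial sums are dominated by `|g| exp |s|
≤ |g| (exp s + exp (-s))`, a product of two square integrable functions. -/
theorem integral_mul_cexp_linear_eq_zero {g : (ι → ℝ) → ℝ} (hg : MemLp g 2 (stdGauss ι))
    (h : ∀ v, hermiteCoeff g v = 0) (t : ι → ℝ) :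
    ∫ w, (g w : ℂ) * Complex.exp ((∑ j, t j * w j : ℝ) * Complex.I) ∂(stdGauss ι) = 0 := by
  set s : (ι → ℝ) → ℝ := fun w => ∑ j, t j * w j
  have lim : Tendsto (fun N : ℕ => ∫ w, ∑ k ∈ Finset.range N,
      (Complex.I ^ k / k !) * ((g w * s w ^ k : ℝ) : ℂ) ∂(stdGauss ι)) atTop
      (𝓝 (∫ w, (g w : ℂ) * Complex.exp (s w * Complex.I) ∂(stdGauss ι))) := by
    refine tendsto_integral_of_dominated_convergence
      (fun w => |g w| * (Real.exp (s w) + Real.exp (-s w))) ?_ ?_ ?_ ?_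
    · intro N
      refine Finset.aestronglyMeasurable_fun_sum _ fun k _ => AEStronglyMeasurable.const_mul ?_ _
      exact Complex.continuous_ofReal.comp_aestronglyMeasurable
        (integral_mul_linear_pow_eq_zero hg h t k).1.aestronglyMeasurable
    · have e2 := memLp_exp_linear fun j => -t j
      simp only [neg_mul, Finset.sum_neg_distrib] at e2
      exact hg.abs.integrable_mul ((memLp_exp_linear t).add e2)
    · intro N
      refine Eventually.of_forall fun w => ?_
      refine (norm_sum_le _ _).trans ?_
      have e : ∀ k ∈ Finset.range N, ‖(Complex.I ^ k / k !) * ((g w * s w ^ k : ℝ) : ℂ)‖ =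
          |g w| * (|s w| ^ k / k !) := by
        intro k _
        rw [norm_mul, norm_div, norm_pow, Complex.norm_I, one_pow, Complex.norm_natCast,
          Complex.norm_real, Real.norm_eq_abs, abs_mul, abs_pow]
        ring
      rw [Finset.sum_congr rfl e, ← Finset.mul_sum]
      refine mul_le_mul_of_nonneg_left ?_ (abs_nonneg _)
      exact (Real.sum_le_exp_of_nonneg (abs_nonneg _) N).trans (Real.exp_abs_le _)
    · refine Eventually.of_forall fun w => ?_
      have := (NormedSpace.expSeries_div_hasSum_exp (𝔸 := ℂ) ((s w : ℂ) * Complex.I)).tendsto_sum_nat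
      rw [← Complex.exp_eq_exp_ℂ] at this
      refine (this.const_mul (g w : ℂ)).congr fun N => ?_
      rw [Finset.mul_sum]
      refine Finset.sum_congr rfl fun k _ => ?_
      push_cast
      rw [mul_pow]
      ring
  refine tendsto_nhds_unique lim ?_
  have z : ∀ N : ℕ, ∫ w, ∑ k ∈ Finset.range N,
      (Complex.I ^ k / k !) * ((g w * s w ^ k : ℝ) : ℂ) ∂(stdGauss ι) = 0 := by
    intro N
    have i (k : ℕ) : Integrable (fun w => g w * s w ^ k) (stdGauss ι) ∧
        ∫ w, g w * s w ^ k ∂(stdGauss ι) = 0 := integral_mul_linear_pow_eq_zero hg h t k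
    have ic (k : ℕ) : Integrable (fun w => ((g w * s w ^ k : ℝ) : ℂ)) (stdGauss ι) := (i k).1.ofReal
    rw [integral_finsetSum _ fun k _ => (ic k).const_mul _]
    refine Finset.sum_eq_zero fun k _ => ?_
    rw [integral_const_mul]
    have := integral_ofReal (𝕜 := ℂ) (μ := stdGauss ι) (f := fun w => g w * s w ^ k)
    rw [(i k).2] at this
    simp only [Complex.coe_algebraMap] at this
    rw [this]
    simp
  simp only [z]
  exact tendsto_const_nhds

/-- Completeness of the Hermite products. -/
theorem ae_eq_zero_of_hermiteCoeff_eq_zero {g : (ι → ℝ) → ℝ} (hg : MemLp g 2 (stdGauss ι))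
    (h : ∀ v, hermiteCoeff g v = 0) : g =ᵐ[stdGauss ι] 0 := by
  classical
  have gi : Integrable g (stdGauss ι) := hg.integrable (by norm_num)
  have fin {f : (ι → ℝ) → ℝ} (hf : Integrable f (stdGauss ι)) :
      ∫⁻ w, ENNReal.ofReal (f w) ∂(stdGauss ι) ≠ ⊤ :=
    ((lintegral_mono fun w => Real.ofReal_le_enorm (f w)).trans_lt hf.2).ne
  have i1 : IsFiniteMeasure ((stdGauss ι).withDensity fun w => ENNReal.ofReal (g w)) :=
    isFiniteMeasure_withDensity (fin gi)
  have i2 : IsFiniteMeasure ((stdGauss ι).withDensity fun w => ENNReal.ofReal (-g w)) :=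
    isFiniteMeasure_withDensity (fin gi.neg)
  have ga : AEMeasurable g (stdGauss ι) := gi.aemeasurable
  have ga1 : AEMeasurable (fun w => ENNReal.ofReal (g w)) (stdGauss ι) := ga.ennreal_ofReal
  have ga2 : AEMeasurable (fun w => ENNReal.ofReal (-g w)) (stdGauss ι) := ga.neg.ennreal_ofReal
  have bdd (L : StrongDual ℝ (ι → ℝ)) {f : (ι → ℝ) → ℝ} (hf : Integrable f (stdGauss ι)) :
      Integrable (fun w => f w • Complex.exp (L w * Complex.I)) (stdGauss ι) :=
    hf.smul_bdd 1 (Continuous.aestronglyMeasurable (by fun_prop))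
      (Eventually.of_forall fun w => by simp [Complex.norm_exp_ofReal_mul_I])
  -- The positive and negative parts of `g` are densities of finite measures with the same
  -- characteristic function, so these measures coincide.
  have eq : (stdGauss ι).withDensity (fun w => ENNReal.ofReal (g w)) =
      (stdGauss ι).withDensity fun w => ENNReal.ofReal (-g w) := by
    refine Measure.ext_of_charFunDual (funext fun L => ?_)
    rw [charFunDual_apply, charFunDual_apply,
      integral_withDensity_eq_integral_toReal_smul₀ ga1 (by simp),
      integral_withDensity_eq_integral_toReal_smul₀ ga2 (by simp), ← sub_eq_zero, ← integral_sub]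
    · have hL : ∀ w : ι → ℝ, L w = ∑ j, L (Pi.single j 1) * w j := by
        intro w
        conv_lhs => rw [← Finset.univ_sum_single w, map_sum]
        refine Finset.sum_congr rfl fun j _ => ?_
        rw [mul_comm, ← smul_eq_mul, ← map_smul, ← Pi.single_smul, smul_eq_mul, mul_one]
      rw [← integral_mul_cexp_linear_eq_zero hg h fun j => L (Pi.single j 1)]
      refine integral_congr_ae (Eventually.of_forall fun w => ?_)
      simp only [← sub_smul, ENNReal.toReal_ofReal', ← hL]
      have : max (g w) 0 - max (-g w) 0 = g w := max_zero_sub_max_neg_zero_eq_self _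
      rw [this, Complex.real_smul]
    · exact bdd L (integrable_toReal_of_lintegral_ne_top ga1 (fin gi))
    · exact bdd L (integrable_toReal_of_lintegral_ne_top ga2 (fin gi.neg))
  have := (withDensity_eq_iff ga1 ga2 (fin gi)).1 eq
  filter_upwards [this] with w hw
  have hw' := congrArg ENNReal.toReal hw
  simp only [ENNReal.toReal_ofReal'] at hw'
  have := max_zero_sub_max_neg_zero_eq_self (g w)
  simp only [Pi.zero_apply]
  linarith

theorem inner_toLp {Ω : Type*} [MeasurableSpace Ω] {μ : Measure Ω} {f g : Ω → ℝ} (hf : MemLp f 2 μ)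
    (hg : MemLp g 2 μ) : inner ℝ (hf.toLp f) (hg.toLp g) = ∫ w, f w * g w ∂μ := by
  rw [L2.inner_def]
  refine integral_congr_ae ?_
  filter_upwards [hf.coeFn_toLp, hg.coeFn_toLp] with w h1 h2
  simp [h1, h2, mul_comm]

/-- Parseval's identity for the Hermite expansion. -/
theorem hasSum_hermiteCoeff_sq {G : (ι → ℝ) → ℝ} (hG : MemLp G 2 (stdGauss ι)) :
    HasSum (fun v => hermiteCoeff G v ^ 2 / (multiFactorial v : ℝ)) (∫ w, G w ^ 2 ∂(stdGauss ι)) := by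
  classical
  let b : (ι → ℕ) → Lp ℝ 2 (stdGauss ι) := fun v =>
    (√(multiFactorial v : ℝ))⁻¹ • (memLp_hermiteProd v).toLp (hermiteProd v)
  have hpos (v : ι → ℕ) : 0 < √(multiFactorial v : ℝ) := Real.sqrt_pos.2 (multiFactorial_pos v)
  have on : Orthonormal ℝ b := by
    rw [orthonormal_iff_ite]
    intro v u
    simp only [b, inner_smul_left, inner_smul_right, inner_toLp,
      integral_hermiteProd_mul_hermiteProd]
    split_ifs with hvu
    · subst hvu
      have := Real.mul_self_sqrt (multiFactorial_pos v).le
      have := (hpos v).ne'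
      simp only [conj_trivial]
      field_simp
      nlinarith
    · simp
  have inner_eq {F : (ι → ℝ) → ℝ} (hF : MemLp F 2 (stdGauss ι)) (v : ι → ℕ) :
      inner ℝ (hF.toLp F) (b v) = (√(multiFactorial v : ℝ))⁻¹ * hermiteCoeff F v := by
    simp only [b, inner_smul_right, inner_toLp]
    rfl
  have bot : (Submodule.span ℝ (Set.range b))ᗮ = ⊥ := by
    rw [eq_bot_iff]
    intro f hf
    rw [Submodule.mem_bot, ← Lp.toLp_coeFn f (Lp.memLp f)]
    have : ∀ v, hermiteCoeff f v = 0 := by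
      intro v
      have h1 := inner_eq (Lp.memLp f) v
      rw [Lp.toLp_coeFn, real_inner_comm,
        (Submodule.mem_orthogonal _ f).1 hf (b v) (Submodule.subset_span ⟨v, rfl⟩)] at h1
      exact (mul_eq_zero.1 h1.symm).resolve_left (inv_ne_zero (hpos v).ne')
    exact (MemLp.toLp_eq_toLp_iff (Lp.memLp f) MemLp.zero).2
      (ae_eq_zero_of_hermiteCoeff_eq_zero (Lp.memLp f) this)
  have key := (HilbertBasis.mkOfOrthogonalEqBot on bot).hasSum_inner_mul_inner
    (hG.toLp G) (hG.toLp G)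
  rw [HilbertBasis.coe_mkOfOrthogonalEqBot, inner_toLp] at key
  have e : ∫ w, G w ^ 2 ∂(stdGauss ι) = ∫ w, G w * G w ∂(stdGauss ι) := by simp only [pow_two]
  rw [e]
  refine key.congr_fun ?_
  intro v
  rw [real_inner_comm (hG.toLp G) (b v), inner_eq hG]
  have h1 := Real.sq_sqrt (multiFactorial_pos v).le
  have h2 := (hpos v).ne'
  generalize √(multiFactorial v : ℝ) = s at h1 h2
  rw [← h1]
  field_simp

/-- The partial sum of the Hermite expansion of `G` over a finite set `S` of multi-indices. -/
noncomputable def hermitePartial (G : (ι → ℝ) → ℝ) (S : Finset (ι → ℕ)) (w : ι → ℝ) : ℝ :=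
  ∑ v ∈ S, hermiteCoeff G v / (multiFactorial v : ℝ) * hermiteProd v w

theorem memLp_hermitePartial (G : (ι → ℝ) → ℝ) (S : Finset (ι → ℕ)) :
    MemLp (hermitePartial G S) 2 (stdGauss ι) :=
  memLp_finsetSum _ fun v _ => (memLp_hermiteProd v).const_mul _

theorem hermiteCoeff_hermitePartial [DecidableEq ι] (G : (ι → ℝ) → ℝ) (S : Finset (ι → ℕ))
    (v : ι → ℕ) :
    hermiteCoeff (hermitePartial G S) v = if v ∈ S then hermiteCoeff G v else 0 := by
  rw [hermiteCoeff]
  simp only [hermitePartial, Finset.sum_mul, mul_assoc]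
  rw [integral_finsetSum _ fun u _ =>
    (integrable_mul_of_memLp (memLp_hermiteProd u) (memLp_hermiteProd v)).const_mul _]
  simp only [integral_const_mul, integral_hermiteProd_mul_hermiteProd, mul_ite, mul_zero]
  rw [Finset.sum_ite_eq']
  split_ifs
  · rw [div_mul_cancel₀ _ (multiFactorial_pos v).ne']
  · rfl

theorem hermiteCoeff_sub {F G : (ι → ℝ) → ℝ} (hF : MemLp F 2 (stdGauss ι))
    (hG : MemLp G 2 (stdGauss ι)) (v : ι → ℕ) :
    hermiteCoeff (fun w => F w - G w) v = hermiteCoeff F v - hermiteCoeff G v := by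
  simp only [hermiteCoeff, sub_mul]
  exact integral_sub (integrable_mul_of_memLp hF (memLp_hermiteProd v))
    (integrable_mul_of_memLp hG (memLp_hermiteProd v))

/-- Parseval applied to the remainder, whose coefficients are those of `G` outside `S`. -/
theorem tendsto_integral_sub_hermitePartial_sq {G : (ι → ℝ) → ℝ} (hG : MemLp G 2 (stdGauss ι)) :
    Tendsto (fun S => ∫ w, (G w - hermitePartial G S w) ^ 2 ∂(stdGauss ι)) atTop (𝓝 0) := by
  classical
  have e (S : Finset (ι → ℕ)) : ∫ w, (G w - hermitePartial G S w) ^ 2 ∂(stdGauss ι) =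
      ∫ w, G w ^ 2 ∂(stdGauss ι) - ∑ v ∈ S, hermiteCoeff G v ^ 2 / (multiFactorial v : ℝ) := by
    have h1 := hasSum_hermiteCoeff_sq (hG.sub (memLp_hermitePartial G S))
    have h2 := (hasSum_hermiteCoeff_sq hG).sub (hasSum_sum_of_ne_finset_zero
      (f := fun v => if v ∈ S then hermiteCoeff G v ^ 2 / (multiFactorial v : ℝ) else 0) (s := S)
      fun v hv => if_neg hv)
    rw [Finset.sum_congr rfl fun v hv => if_pos hv] at h2
    refine h1.unique (h2.congr_fun ?_)
    intro v
    have := hermiteCoeff_sub hG (memLp_hermitePartial G S) v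
    rw [hermiteCoeff_hermitePartial] at this
    change hermiteCoeff (fun w => G w - hermitePartial G S w) v ^ 2 / _ = _
    rw [this]
    split_ifs <;> simp
  simp only [e]
  have := (hasSum_hermiteCoeff_sq hG).const_sub (∫ w, G w ^ 2 ∂(stdGauss ι))
  simpa using this

end HermiteExpansion

/-! ### Mean-square estimates for parameter integrals. -/

section SquareIntegrable

variable {Ω : Type*} [MeasurableSpace Ω] {P : Measure Ω}

theorem norm_toLp_eq_sqrt {f : Ω → ℝ} (hf : MemLp f 2 P) : ‖hf.toLp f‖ = √(∫ ω, f ω ^ 2 ∂P) := by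
  rw [norm_eq_sqrt_real_inner, inner_toLp]
  simp only [pow_two]

theorem abs_sqrt_integral_sq_sub_le {f g : Ω → ℝ} (hf : MemLp f 2 P) (hg : MemLp g 2 P) :
    |√(∫ ω, f ω ^ 2 ∂P) - √(∫ ω, g ω ^ 2 ∂P)| ≤ √(∫ ω, (f ω - g ω) ^ 2 ∂P) := by
  have h := norm_toLp_eq_sqrt (hf.sub hg)
  simp only [Pi.sub_apply] at h
  rw [← norm_toLp_eq_sqrt hf, ← norm_toLp_eq_sqrt hg, ← h, MemLp.toLp_sub]
  exact abs_norm_sub_norm_le _ _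

theorem sq_integral_le [IsFiniteMeasure P] {f : Ω → ℝ} (hf : MemLp f 2 P) :
    (∫ ω, f ω ∂P) ^ 2 ≤ P.real Set.univ * ∫ ω, f ω ^ 2 ∂P := by
  have h1 : MemLp (fun _ : Ω => (1 : ℝ)) 2 P := memLp_const 1
  have h := real_inner_mul_inner_self_le (h1.toLp _) (hf.toLp f)
  simp only [inner_toLp, one_mul, integral_const, smul_eq_mul, mul_one] at h
  simpa only [pow_two] using h

variable {X : Type*} [MeasurableSpace X] {μ : Measure X} [IsFiniteMeasure μ]

/-- Cauchy–Schwarz in `x` for almost every `ω`, then Fubini. -/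
theorem memLp_integral_of_memLp_prod [IsFiniteMeasure P] {f : X × Ω → ℝ}
    (hf : MemLp f 2 (μ.prod P)) :
    MemLp (fun ω => ∫ x, f (x, ω) ∂μ) 2 P ∧
    ∫ ω, (∫ x, f (x, ω) ∂μ) ^ 2 ∂P ≤ μ.real Set.univ * ∫ p, f p ^ 2 ∂(μ.prod P) := by
  have hsq := hf.integrable_sq
  have hmeas : AEStronglyMeasurable (fun ω => ∫ x, f (x, ω) ∂μ) P :=
    (hf.integrable (by norm_num)).integral_prod_right.aestronglyMeasurable
  have hm : ∀ᵐ ω ∂P, AEStronglyMeasurable (fun x => f (x, ω)) μ := by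
    filter_upwards [(hf.integrable (by norm_num)).prod_left_ae] with ω h using h.aestronglyMeasurable
  have hle : ∀ᵐ ω ∂P, (∫ x, f (x, ω) ∂μ) ^ 2 ≤ μ.real Set.univ * ∫ x, f (x, ω) ^ 2 ∂μ := by
    filter_upwards [hm, hsq.prod_left_ae] with ω h1 h2
    exact sq_integral_le ((memLp_two_iff_integrable_sq h1).2 h2)
  have hint : Integrable (fun ω => μ.real Set.univ * ∫ x, f (x, ω) ^ 2 ∂μ) P :=
    hsq.integral_prod_right.const_mul _
  have hsqi : Integrable (fun ω => (∫ x, f (x, ω) ∂μ) ^ 2) P := by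
    refine hint.mono' (hmeas.pow 2) ?_
    filter_upwards [hle] with ω h
    rwa [Real.norm_of_nonneg (sq_nonneg _)]
  refine ⟨(memLp_two_iff_integrable_sq hmeas).2 hsqi, ?_⟩
  rw [integral_prod_symm _ hsq, ← integral_const_mul]
  exact integral_mono_ae hsqi hint hle

end SquareIntegrable

/-! ### Integrals along a field with standard Gaussian marginals. -/

section StandardMarginals

variable {ι : Type*} [Fintype ι] {Ω X : Type*} [MeasurableSpace Ω] [MeasurableSpace X]
  {P : Measure Ω} [IsProbabilityMeasure P] {ξ : X → Ω → ι → ℝ}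

/-- All slices have the same law, so integrability questions on `X × Ω` reduce to the Gaussian space
without reference to joint laws at distinct points. -/
theorem map_uncurry_of_map_eq (hξ : Measurable fun p : X × Ω => ξ p.1 p.2)
    (hlaw : ∀ x, P.map (ξ x) = stdGauss ι) (μ : Measure X) [IsFiniteMeasure μ] :
    (μ.prod P).map (fun p => ξ p.1 p.2) = μ Set.univ • stdGauss ι := by
  ext N hN
  rw [Measure.map_apply hξ hN, Measure.prod_apply (hξ hN)]
  have : ∀ x, P (Prod.mk x ⁻¹' ((fun p : X × Ω => ξ p.1 p.2) ⁻¹' N)) = stdGauss ι N := by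
    intro x
    have hx : Measurable (ξ x) := hξ.comp measurable_prodMk_left
    rw [← hlaw x, Measure.map_apply hx hN]
    rfl
  simp [this, mul_comm]

theorem memLp_comp_field (hξ : Measurable fun p : X × Ω => ξ p.1 p.2)
    (hlaw : ∀ x, P.map (ξ x) = stdGauss ι) (μ : Measure X) [IsFiniteMeasure μ] {F : (ι → ℝ) → ℝ}
    (hF : MemLp F 2 (stdGauss ι)) :
    MemLp (fun p : X × Ω => F (ξ p.1 p.2)) 2 (μ.prod P) ∧
    ∫ p, F (ξ p.1 p.2) ^ 2 ∂(μ.prod P) = μ.real Set.univ * ∫ w, F w ^ 2 ∂(stdGauss ι) := by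
  have h : MemLp F 2 ((μ.prod P).map fun p => ξ p.1 p.2) := by
    rw [map_uncurry_of_map_eq hξ hlaw]
    exact hF.smul_measure (measure_ne_top _ _)
  refine ⟨h.comp_of_map hξ.aemeasurable, ?_⟩
  rw [← integral_map hξ.aemeasurable (f := fun w => F w ^ 2) (h.aestronglyMeasurable.pow 2),
    map_uncurry_of_map_eq hξ hlaw, integral_smul_measure]
  rfl

/-- The integral of `F` along the field. -/
noncomputable def fieldIntegral (ξ : X → Ω → ι → ℝ) (μ : Measure X) (F : (ι → ℝ) → ℝ) (ω : Ω) : ℝ :=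
  ∫ x, F (ξ x ω) ∂μ

theorem ae_integrable_field (hξ : Measurable fun p : X × Ω => ξ p.1 p.2)
    (hlaw : ∀ x, P.map (ξ x) = stdGauss ι) (μ : Measure X) [IsFiniteMeasure μ]
    {F : (ι → ℝ) → ℝ} (hF : MemLp F 2 (stdGauss ι)) :
    ∀ᵐ ω ∂P, Integrable (fun x => F (ξ x ω)) μ :=
  ((memLp_comp_field hξ hlaw μ hF).1.integrable (by norm_num)).prod_left_ae

theorem memLp_fieldIntegral (hξ : Measurable fun p : X × Ω => ξ p.1 p.2)
    (hlaw : ∀ x, P.map (ξ x) = stdGauss ι) (μ : Measure X) [IsFiniteMeasure μ]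
    {F : (ι → ℝ) → ℝ} (hF : MemLp F 2 (stdGauss ι)) :
    MemLp (fieldIntegral ξ μ F) 2 P :=
  (memLp_integral_of_memLp_prod (memLp_comp_field hξ hlaw μ hF).1).1

/-- Mean-square continuity in `F`, which carries identities from finite Hermite sums to general
functions. -/
theorem integral_fieldIntegral_sq_le (hξ : Measurable fun p : X × Ω => ξ p.1 p.2)
    (hlaw : ∀ x, P.map (ξ x) = stdGauss ι) (μ : Measure X) [IsFiniteMeasure μ]
    {F : (ι → ℝ) → ℝ} (hF : MemLp F 2 (stdGauss ι)) :
    ∫ ω, fieldIntegral ξ μ F ω ^ 2 ∂P ≤ μ.real Set.univ ^ 2 * ∫ w, F w ^ 2 ∂(stdGauss ι) := by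
  have h := memLp_comp_field hξ hlaw μ hF
  have := (memLp_integral_of_memLp_prod h.1).2
  rw [h.2] at this
  rw [pow_two, mul_assoc]
  exact this

theorem integral_fieldIntegral (hξ : Measurable fun p : X × Ω => ξ p.1 p.2)
    (hlaw : ∀ x, P.map (ξ x) = stdGauss ι) (μ : Measure X) [IsFiniteMeasure μ]
    {F : (ι → ℝ) → ℝ} (hF : MemLp F 2 (stdGauss ι)) :
    ∫ ω, fieldIntegral ξ μ F ω ∂P = μ.real Set.univ * ∫ w, F w ∂(stdGauss ι) := by
  have h := (memLp_comp_field hξ hlaw μ hF).1.integrable (by norm_num)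
  have e := integral_integral_swap (f := fun x ω => F (ξ x ω)) h
  simp only [fieldIntegral]
  rw [← e]
  have : ∀ x, ∫ ω, F (ξ x ω) ∂P = ∫ w, F w ∂(stdGauss ι) := by
    intro x
    have hx : Measurable (ξ x) := hξ.comp measurable_prodMk_left
    rw [← hlaw x, integral_map hx.aemeasurable (by rw [hlaw x]; exact hF.aestronglyMeasurable)]
  simp [this]

/-- Only almost sure: on paths where an integrand is not integrable, its integral is `0` by
convention and linearity can fail. -/
theorem fieldIntegral_sub_ae (hξ : Measurable fun p : X × Ω => ξ p.1 p.2)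
    (hlaw : ∀ x, P.map (ξ x) = stdGauss ι) (μ : Measure X) [IsFiniteMeasure μ]
    {F H : (ι → ℝ) → ℝ} (hF : MemLp F 2 (stdGauss ι))
    (hH : MemLp H 2 (stdGauss ι)) :
    fieldIntegral ξ μ (fun w => F w - H w) =ᵐ[P]
      fun ω => fieldIntegral ξ μ F ω - fieldIntegral ξ μ H ω := by
  filter_upwards [ae_integrable_field hξ hlaw μ hF, ae_integrable_field hξ hlaw μ hH] with ω h1 h2
  exact integral_sub h1 h2

theorem fieldIntegral_hermitePartial_ae (hξ : Measurable fun p : X × Ω => ξ p.1 p.2)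
    (hlaw : ∀ x, P.map (ξ x) = stdGauss ι) (μ : Measure X) [IsFiniteMeasure μ]
    (G : (ι → ℝ) → ℝ) (S : Finset (ι → ℕ)) :
    fieldIntegral ξ μ (hermitePartial G S) =ᵐ[P] fun ω =>
      ∑ v ∈ S, hermiteCoeff G v / (multiFactorial v : ℝ) * fieldIntegral ξ μ (hermiteProd v) ω := by
  have h : ∀ᵐ ω ∂P, ∀ v ∈ S, Integrable (fun x => hermiteProd v (ξ x ω)) μ := by
    rw [Finset.eventually_all]
    exact fun v _ => ae_integrable_field hξ hlaw μ (memLp_hermiteProd v)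
  filter_upwards [h] with ω h
  simp only [fieldIntegral, hermitePartial]
  rw [integral_finsetSum _ fun v hv => (h v hv).const_mul _]
  simp only [integral_const_mul]

theorem integral_fieldIntegral_mul (hξ : Measurable fun p : X × Ω => ξ p.1 p.2)
    (hlaw : ∀ x, P.map (ξ x) = stdGauss ι) (μ : Measure X) [IsFiniteMeasure μ]
    {F H : (ι → ℝ) → ℝ} (hF : MemLp F 2 (stdGauss ι))
    (hH : MemLp H 2 (stdGauss ι)) :
    ∫ ω, fieldIntegral ξ μ F ω * fieldIntegral ξ μ H ω ∂P =
      ∫ z, ∫ ω, F (ξ z.1 ω) * H (ξ z.2 ω) ∂P ∂(μ.prod μ) := by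
  have h1 := (memLp_comp_field (ξ := fun (z : X × X) ω => ξ z.1 ω)
    (hξ.comp (by fun_prop : Measurable fun p : (X × X) × Ω => (p.1.1, p.2))) (fun z => hlaw z.1)
    (μ.prod μ) hF).1
  have h2 := (memLp_comp_field (ξ := fun (z : X × X) ω => ξ z.2 ω)
    (hξ.comp (by fun_prop : Measurable fun p : (X × X) × Ω => (p.1.2, p.2))) (fun z => hlaw z.2)
    (μ.prod μ) hH).1
  have h : Integrable (Function.uncurry fun (z : X × X) ω => F (ξ z.1 ω) * H (ξ z.2 ω))
      ((μ.prod μ).prod P) := h1.integrable_mul h2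
  rw [integral_integral_swap h]
  refine integral_congr_ae (Eventually.of_forall fun ω => ?_)
  exact (integral_prod_mul (fun x => F (ξ x ω)) (fun x => H (ξ x ω))).symm

/-- The second moment of a functional of the field, in terms of the Hermite coefficients. -/
theorem hasSum_integral_fieldIntegral_sq (hξ : Measurable fun p : X × Ω => ξ p.1 p.2)
    (hlaw : ∀ x, P.map (ξ x) = stdGauss ι) (μ : Measure X) [IsFiniteMeasure μ]
    [DecidableEq ι] {c : (ι → ℕ) → X × X → ℝ}
    (hc : ∀ v u x y, ∫ ω, hermiteProd v (ξ x ω) * hermiteProd u (ξ y ω) ∂P =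
      if v = u then (multiFactorial v : ℝ) * c v (x, y) else 0)
    {G : (ι → ℝ) → ℝ} (hG : MemLp G 2 (stdGauss ι)) :
    HasSum (fun v => hermiteCoeff G v ^ 2 / (multiFactorial v : ℝ) * ∫ z, c v z ∂(μ.prod μ))
      (∫ ω, fieldIntegral ξ μ G ω ^ 2 ∂P) := by
  have hp (S : Finset (ι → ℕ)) := memLp_hermitePartial G S
  have e (S : Finset (ι → ℕ)) : ∫ ω, fieldIntegral ξ μ (hermitePartial G S) ω ^ 2 ∂P =
      ∑ v ∈ S, hermiteCoeff G v ^ 2 / (multiFactorial v : ℝ) * ∫ z, c v z ∂(μ.prod μ) := by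
    have e1 : ∫ ω, fieldIntegral ξ μ (hermitePartial G S) ω ^ 2 ∂P =
        ∫ ω, ∑ v ∈ S, ∑ u ∈ S, (hermiteCoeff G v / (multiFactorial v : ℝ) *
          (hermiteCoeff G u / (multiFactorial u : ℝ))) *
          (fieldIntegral ξ μ (hermiteProd v) ω * fieldIntegral ξ μ (hermiteProd u) ω) ∂P := by
      refine integral_congr_ae ?_
      filter_upwards [fieldIntegral_hermitePartial_ae hξ hlaw μ G S] with ω h
      rw [h, pow_two, Finset.sum_mul_sum]
      refine Finset.sum_congr rfl fun v _ => Finset.sum_congr rfl fun u _ => ?_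
      ring
    have i (v u : ι → ℕ) (a : ℝ) : Integrable (fun ω => a *
        (fieldIntegral ξ μ (hermiteProd v) ω * fieldIntegral ξ μ (hermiteProd u) ω)) P :=
      ((memLp_fieldIntegral hξ hlaw μ (memLp_hermiteProd v)).integrable_mul
        (memLp_fieldIntegral hξ hlaw μ (memLp_hermiteProd u))).const_mul a
    rw [e1, integral_finsetSum _ fun v _ => integrable_finsetSum _ fun u _ => i v u _]
    refine Finset.sum_congr rfl fun v hv => ?_
    rw [integral_finsetSum _ fun u _ => i v u _, Finset.sum_eq_single v]
    · rw [integral_const_mul, integral_fieldIntegral_mul hξ hlaw μ (memLp_hermiteProd v)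
        (memLp_hermiteProd v)]
      simp only [hc, if_true]
      rw [integral_const_mul]
      have := (multiFactorial_pos v).ne'
      field_simp
    · intro u _ hu
      rw [integral_const_mul, integral_fieldIntegral_mul hξ hlaw μ (memLp_hermiteProd v)
        (memLp_hermiteProd u)]
      simp only [hc, if_neg hu.symm]
      simp
    · exact fun h => absurd hv h
  -- The identity `e` for finite `S` comes from orthogonality; mean-square continuity now lets `S`
  -- exhaust all multi-indices.
  have lim : Tendsto (fun S => √(∫ ω, (fieldIntegral ξ μ (hermitePartial G S) ω -
      fieldIntegral ξ μ G ω) ^ 2 ∂P)) atTop (𝓝 0) := by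
    have l0 := ((tendsto_integral_sub_hermitePartial_sq hG).const_mul (μ.real Set.univ ^ 2)).sqrt
    rw [mul_zero, Real.sqrt_zero] at l0
    refine squeeze_zero (fun _ => Real.sqrt_nonneg _) (fun S => Real.sqrt_le_sqrt ?_) l0
    refine le_trans (le_of_eq ?_) (integral_fieldIntegral_sq_le hξ hlaw μ (hG.sub (hp S)))
    refine integral_congr_ae ?_
    filter_upwards [fieldIntegral_sub_ae hξ hlaw μ hG (hp S)] with ω h
    rw [h]
    ring
  have lim2 : Tendsto (fun S => √(∫ ω, fieldIntegral ξ μ (hermitePartial G S) ω ^ 2 ∂P)) atTop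
      (𝓝 (√(∫ ω, fieldIntegral ξ μ G ω ^ 2 ∂P))) := by
    rw [tendsto_iff_dist_tendsto_zero]
    refine squeeze_zero (fun _ => dist_nonneg) (fun S => ?_) lim
    exact abs_sqrt_integral_sq_sub_le (memLp_fieldIntegral hξ hlaw μ (hp S))
      (memLp_fieldIntegral hξ hlaw μ hG)
  have lim3 := lim2.pow 2
  rw [Real.sq_sqrt (integral_nonneg fun _ => sq_nonneg _)] at lim3
  refine lim3.congr fun S => ?_
  rw [Real.sq_sqrt (integral_nonneg fun _ => sq_nonneg _), e S]

end StandardMarginals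

/-! ### Covariance structure of the field. -/

section Field

variable {d m n : ℕ} {Ω : Type*} [MeasurableSpace Ω] {P : Measure Ω}
  {α β : ℝ} {L₁ L₂ : ℝ → ℝ} {η : EuclideanSpace ℝ (Fin d) → Ω → (Fin m ⊕ Fin n → ℝ)}

/-- The product of powers of the component covariances attached to a multi-index. -/
noncomputable def covProd (α β : ℝ) (L₁ L₂ : ℝ → ℝ) (v : Fin m ⊕ Fin n → ℕ)
    (x : EuclideanSpace ℝ (Fin d)) : ℝ :=
  ∏ j, covMatrix m n α β L₁ L₂ x j j ^ v j

theorem IsStrongWeakField.measurable_eval (hη : IsStrongWeakField P α β L₁ L₂ η)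
    (x : EuclideanSpace ℝ (Fin d)) : Measurable (η x) :=
  hη.measurable.comp measurable_prodMk_left

theorem IsStrongWeakField.hasGaussianLaw_pair (hη : IsStrongWeakField P α β L₁ L₂ η)
    (x y : EuclideanSpace ℝ (Fin d)) (j : Fin m ⊕ Fin n) :
    HasGaussianLaw (fun ω => (η x ω j, η y ω j)) P := by
  have := (hη.gaussian.hasGaussianLaw_prodMk (s := x) (t := y)).map_fun
    (((ContinuousLinearMap.proj j).comp (ContinuousLinearMap.fst ℝ _ _)).prod
      ((ContinuousLinearMap.proj j).comp (ContinuousLinearMap.snd ℝ _ _)) :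
      ((Fin m ⊕ Fin n → ℝ) × (Fin m ⊕ Fin n → ℝ)) →L[ℝ] ℝ × ℝ)
  simpa using this

theorem IsStrongWeakField.aemeasurable_component (hη : IsStrongWeakField P α β L₁ L₂ η)
    (x : EuclideanSpace ℝ (Fin d)) (j : Fin m ⊕ Fin n) : AEMeasurable (fun ω => η x ω j) P :=
  ((measurable_pi_apply j).comp (hη.measurable_eval x)).aemeasurable

theorem IsStrongWeakField.variance_eq_one (hη : IsStrongWeakField P α β L₁ L₂ η)
    (x : EuclideanSpace ℝ (Fin d)) (j : Fin m ⊕ Fin n) : variance (fun ω => η x ω j) P = 1 := by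
  rw [← covariance_self (hη.aemeasurable_component x j), hη.cov_eq]
  simp [covMatrix]

variable [IsProbabilityMeasure P]

theorem IsStrongWeakField.map_eq_stdGauss (hη : IsStrongWeakField P α β L₁ L₂ η)
    (x : EuclideanSpace ℝ (Fin d)) : P.map (η x) = stdGauss (Fin m ⊕ Fin n) := by
  have ind : iIndepFun (fun j ω => η x ω j) P :=
    hη.indep.comp (fun _ path => path x) fun _ => measurable_pi_apply x
  have := (iIndepFun_iff_map_fun_eq_pi_map (hη.aemeasurable_component x)).1 ind
  change P.map (fun ω j => η x ω j) = _
  rw [this, stdGauss]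
  congr 1
  ext1 j
  exact map_eq_gaussianReal_of_moments (hη.hasGaussianLaw_pair x x j).fst (hη.mean_zero x j)
    (hη.variance_eq_one x j)

/-- Independence of the components factors the moment over coordinates; one coordinate with
different degrees makes it vanish. -/
theorem IsStrongWeakField.integral_hermiteProd_mul (hη : IsStrongWeakField P α β L₁ L₂ η)
    (v u : Fin m ⊕ Fin n → ℕ) (x y : EuclideanSpace ℝ (Fin d)) :
    ∫ ω, hermiteProd v (η x ω) * hermiteProd u (η y ω) ∂P =
      if v = u then (multiFactorial v : ℝ) * covProd α β L₁ L₂ v (x - y) else 0 := by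
  have ind : iIndepFun (fun (j : Fin m ⊕ Fin n) ω => (η x ω j, η y ω j)) P :=
    hη.indep.comp (fun _ path => (path x, path y)) fun _ => by fun_prop
  simp only [hermiteProd_eq, ← Finset.prod_mul_distrib]
  rw [ind.integral_fun_prod_comp
    (f := fun j (z : ℝ × ℝ) => (realHermite (v j)).eval z.1 * (realHermite (u j)).eval z.2)
    (fun j => (hη.hasGaussianLaw_pair x y j).aemeasurable)
    (fun j => (((realHermite (v j)).continuous.comp continuous_fst).mul
      ((realHermite (u j)).continuous.comp continuous_snd)).aestronglyMeasurable)]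
  have h (j : Fin m ⊕ Fin n) := integral_realHermite_mul_realHermite (hη.hasGaussianLaw_pair x y j)
    (hη.mean_zero x j) (hη.variance_eq_one x j) (hη.mean_zero y j) (hη.variance_eq_one y j)
    (v j) (u j)
  simp only [h, hη.cov_eq]
  split_ifs with hvu
  · subst hvu
    simp [Finset.prod_mul_distrib, multiFactorial, covProd]
  · obtain ⟨j, hj⟩ := Function.ne_iff.1 hvu
    exact Finset.prod_eq_zero (Finset.mem_univ j) (if_neg hj)

/-- The increment from `0` to `x` has variance `2 - 2 B_jj(x) ≥ 0`. -/
theorem IsStrongWeakField.covMatrix_le_one (hη : IsStrongWeakField P α β L₁ L₂ η)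
    (x : EuclideanSpace ℝ (Fin d)) (j : Fin m ⊕ Fin n) : covMatrix m n α β L₁ L₂ x j j ≤ 1 := by
  have g := hη.hasGaussianLaw_pair x 0 j
  have h1 := variance_sub g.fst.memLp_two g.snd.memLp_two
  have h2 := variance_nonneg ((fun ω => η x ω j) - fun ω => η 0 ω j) P
  rw [h1, hη.variance_eq_one, hη.variance_eq_one, hη.cov_eq, sub_zero] at h2
  linarith

end Field

/-! ### From relative mean-square closeness to limit laws. -/

section Normalization

variable {Ω : Type*} [MeasurableSpace Ω] {P : Measure Ω}

theorem tendstoInMeasure_zero_of_integral_sq {F : ℝ → Ω → ℝ} (hF : ∀ r, MemLp (F r) 2 P)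
    (h : Tendsto (fun r => ∫ ω, F r ω ^ 2 ∂P) atTop (𝓝 0)) : TendstoInMeasure P F atTop 0 := by
  refine tendstoInMeasure_of_tendsto_eLpNorm (p := 2) (by simp)
    (fun r => (hF r).aestronglyMeasurable) aestronglyMeasurable_zero ?_
  have e (r : ℝ) : eLpNorm (F r - 0) 2 P = ENNReal.ofReal √(∫ ω, F r ω ^ 2 ∂P) := by
    rw [sub_zero, ← norm_toLp_eq_sqrt (hF r), Lp.norm_toLp, ENNReal.ofReal_toReal (hF r).2.ne]
  simp only [e]
  have := ENNReal.tendsto_ofReal h.sqrt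
  simpa using this

variable [IsProbabilityMeasure P]

theorem hasLimitLaw_of_hasLimitLaw {X Y : ℝ → Ω → ℝ} (hX : ∀ r, MemLp (X r) 2 P)
    (hY : ∀ r, MemLp (Y r) 2 P)
    (h : Tendsto (fun r => ∫ ω, (X r ω / √(variance (X r) P) - Y r ω / √(variance (Y r) P)) ^ 2 ∂P)
      atTop (𝓝 0)) (ν : Measure ℝ) [IsProbabilityMeasure ν] (hν : HasLimitLaw P Y ν) :
    HasLimitLaw P X ν := by
  have mX (r : ℝ) : MemLp (fun ω => X r ω / √(variance (X r) P)) 2 P := by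
    simpa only [div_eq_mul_inv] using (hX r).mul_const _
  have mY (r : ℝ) : MemLp (fun ω => Y r ω / √(variance (Y r) P)) 2 P := by
    simpa only [div_eq_mul_inv] using (hY r).mul_const _
  refine tendstoInDistribution_of_tendstoInMeasure_sub _ _ hν ?_ fun r =>
    (mX r).aestronglyMeasurable.aemeasurable
  exact tendstoInMeasure_zero_of_integral_sq (fun r => (mX r).sub (mY r)) h

/-- Two centred square integrable families that are asymptotically equal in relative mean square
have equivalent variances and the same limit laws after normalization. -/
theorem isEquivalent_and_hasLimitLaw_iff {X Y : ℝ → Ω → ℝ} (hX : ∀ r, MemLp (X r) 2 P)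
    (hY : ∀ r, MemLp (Y r) 2 P) (hX0 : ∀ r, ∫ ω, X r ω ∂P = 0) (hY0 : ∀ r, ∫ ω, Y r ω ∂P = 0)
    (hXpos : ∀ r, 0 < r → 0 < ∫ ω, X r ω ^ 2 ∂P) (hYpos : ∀ r, 0 < r → 0 < ∫ ω, Y r ω ^ 2 ∂P)
    (h : Tendsto (fun r => (∫ ω, (X r ω - Y r ω) ^ 2 ∂P) / ∫ ω, Y r ω ^ 2 ∂P) atTop (𝓝 0)) :
    Asymptotics.IsEquivalent atTop (fun r => variance (X r) P) (fun r => variance (Y r) P) ∧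
    ∀ (ν : Measure ℝ) [IsProbabilityMeasure ν], HasLimitLaw P X ν ↔ HasLimitLaw P Y ν := by
  have vX (r : ℝ) : variance (X r) P = ∫ ω, X r ω ^ 2 ∂P :=
    variance_of_integral_eq_zero (hX r).aestronglyMeasurable.aemeasurable (hX0 r)
  have vY (r : ℝ) : variance (Y r) P = ∫ ω, Y r ω ^ 2 ∂P :=
    variance_of_integral_eq_zero (hY r).aestronglyMeasurable.aemeasurable (hY0 r)
  set a : ℝ → ℝ := fun r => √(∫ ω, X r ω ^ 2 ∂P) with ha
  set b : ℝ → ℝ := fun r => √(∫ ω, Y r ω ^ 2 ∂P) with hb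
  have apos : ∀ r, 0 < r → 0 < a r := fun r hr => Real.sqrt_pos.2 (hXpos r hr)
  have bpos : ∀ r, 0 < r → 0 < b r := fun r hr => Real.sqrt_pos.2 (hYpos r hr)
  have asq (r : ℝ) : a r ^ 2 = ∫ ω, X r ω ^ 2 ∂P :=
    Real.sq_sqrt (integral_nonneg fun _ => sq_nonneg _)
  have bsq (r : ℝ) : b r ^ 2 = ∫ ω, Y r ω ^ 2 ∂P :=
    Real.sq_sqrt (integral_nonneg fun _ => sq_nonneg _)
  -- Reverse triangle inequality for the mean-square norms `a` of `X` and `b` of `Y`.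
  have hsub : Tendsto (fun r => (a r - b r) / b r) atTop (𝓝 0) := by
    have h' := h.sqrt
    rw [Real.sqrt_zero] at h'
    refine squeeze_zero_norm' ?_ h'
    filter_upwards [eventually_gt_atTop 0] with r hr
    rw [Real.norm_eq_abs, abs_div, abs_of_pos (bpos r hr),
      Real.sqrt_div (integral_nonneg fun _ => sq_nonneg _)]
    exact div_le_div_of_nonneg_right (abs_sqrt_integral_sq_sub_le (hX r) (hY r)) (bpos r hr).le
  have hdiv : Tendsto (fun r => a r / b r) atTop (𝓝 1) := by
    have := hsub.add_const 1
    rw [zero_add] at this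
    refine this.congr' ?_
    filter_upwards [eventually_gt_atTop 0] with r hr
    have := (bpos r hr).ne'
    field_simp
    ring
  have hlaw : Tendsto (fun r => ∫ ω, (X r ω / √(variance (X r) P) -
      Y r ω / √(variance (Y r) P)) ^ 2 ∂P) atTop (𝓝 0) := by
    have hbound := (h.const_mul 2).add ((hsub.pow 2).const_mul 2)
    norm_num at hbound
    refine squeeze_zero' (Eventually.of_forall fun r => integral_nonneg fun _ => sq_nonneg _) ?_
      hbound
    filter_upwards [eventually_gt_atTop 0] with r hr
    rw [vX, vY]
    change ∫ ω, (X r ω / a r - Y r ω / b r) ^ 2 ∂P ≤ _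
    have ha0 := (apos r hr).ne'
    have hb0 := (bpos r hr).ne'
    have i1 : Integrable (fun ω => 2 / b r ^ 2 * (X r ω - Y r ω) ^ 2) P :=
      ((hX r).sub (hY r)).integrable_sq.const_mul _
    have i2 : Integrable (fun ω => 2 * ((a r - b r) / (a r * b r)) ^ 2 * X r ω ^ 2) P :=
      (hX r).integrable_sq.const_mul _
    -- The difference splits into `(X - Y)/b` and a multiple of `X` with mean-square norm `|a -
    -- b|/b`.
    calc ∫ ω, (X r ω / a r - Y r ω / b r) ^ 2 ∂P
        ≤ ∫ ω, (2 / b r ^ 2 * (X r ω - Y r ω) ^ 2 +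
            2 * ((a r - b r) / (a r * b r)) ^ 2 * X r ω ^ 2) ∂P := by
          refine integral_mono_of_nonneg (Eventually.of_forall fun ω => sq_nonneg _) (i1.add i2)
            (Eventually.of_forall fun ω => ?_)
          have e1 : X r ω / a r - Y r ω / b r =
              (X r ω - Y r ω) / b r - (a r - b r) / (a r * b r) * X r ω := by
            field_simp
            ring
          have e2 : 2 / b r ^ 2 * (X r ω - Y r ω) ^ 2 = 2 * ((X r ω - Y r ω) / b r) ^ 2 := by
            field_simp
          simp only
          rw [e1, e2]
          nlinarith [sq_nonneg ((X r ω - Y r ω) / b r + (a r - b r) / (a r * b r) * X r ω)]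
      _ = 2 * ((∫ ω, (X r ω - Y r ω) ^ 2 ∂P) / ∫ ω, Y r ω ^ 2 ∂P) +
            2 * ((a r - b r) / b r) ^ 2 := by
          rw [integral_add i1 i2, integral_const_mul, integral_const_mul, ← bsq, ← asq]
          field_simp
  refine ⟨?_, fun ν _ => ⟨fun hν => ?_, fun hν => ?_⟩⟩
  · rw [Asymptotics.isEquivalent_iff_tendsto_one]
    · have := hdiv.pow 2
      rw [one_pow] at this
      refine this.congr fun r => ?_
      rw [Pi.div_apply, vX, vY, ← asq, ← bsq, div_pow]
    · filter_upwards [eventually_gt_atTop 0] with r hr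
      rw [vY]
      exact (hYpos r hr).ne'
  · refine hasLimitLaw_of_hasLimitLaw hY hX (hlaw.congr fun r => ?_) ν hν
    exact integral_congr_ae (Eventually.of_forall fun ω => by simp only; ring)
  · exact hasLimitLaw_of_hasLimitLaw hX hY hlaw ν hν

end Normalization

/-! ### Double integrals over growing windows. -/

section Windows

variable {d : ℕ}

/-- Lebesgue measure on the dilated window. -/
noncomputable def windowMeasure (Δ : Set (EuclideanSpace ℝ (Fin d))) (r : ℝ) :
    Measure (EuclideanSpace ℝ (Fin d)) := volume.restrict (r • Δ)

theorem isFiniteMeasure_windowMeasure {Δ : Set (EuclideanSpace ℝ (Fin d))} (hΔ : IsCompact Δ)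
    (r : ℝ) : IsFiniteMeasure (windowMeasure Δ r) :=
  ⟨by rw [windowMeasure, Measure.restrict_apply_univ]; exact (hΔ.smul r).measure_lt_top⟩

theorem windowMeasure_real_univ (Δ : Set (EuclideanSpace ℝ (Fin d))) {r : ℝ} (hr : 0 < r) :
    (windowMeasure Δ r).real Set.univ = r ^ d * volume.real Δ := by
  rw [windowMeasure, measureReal_restrict_apply_univ, measureReal_def, Measure.addHaar_smul,
    ENNReal.toReal_mul, ENNReal.toReal_ofReal (abs_nonneg _), finrank_euclideanSpace_fin,
    abs_of_pos (pow_pos hr d), measureReal_def]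

theorem integrable_sub_of_bounded {μ : Measure (EuclideanSpace ℝ (Fin d))} [IsFiniteMeasure μ]
    {f : EuclideanSpace ℝ (Fin d) → ℝ} (hf : Measurable f) {C : ℝ} (h : ∀ z, ‖f z‖ ≤ C) :
    Integrable (fun z : EuclideanSpace ℝ (Fin d) × EuclideanSpace ℝ (Fin d) => f (z.1 - z.2))
      (μ.prod μ) :=
  Integrable.of_bound (hf.comp (by fun_prop : Measurable fun z :
    EuclideanSpace ℝ (Fin d) × EuclideanSpace ℝ (Fin d) => z.1 - z.2)).aestronglyMeasurable C
    (Eventually.of_forall fun z => h _)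

theorem measurable_indicator_ball (R : ℝ) : Measurable
    ((Metric.ball (0 : EuclideanSpace ℝ (Fin d)) R).indicator fun _ => (1 : ℝ)) :=
  measurable_const.indicator Metric.isOpen_ball.measurableSet

theorem norm_indicator_ball_le (R : ℝ) (z : EuclideanSpace ℝ (Fin d)) :
    ‖(Metric.ball (0 : EuclideanSpace ℝ (Fin d)) R).indicator (fun _ => (1 : ℝ)) z‖ ≤ 1 := by
  classical
  rw [Set.indicator_apply]
  split_ifs <;> simp

/-- Near-diagonal pairs have measure linear in the volume of the window, against the square of that
volume for all pairs. -/
theorem integral_indicator_ball_le (A : Set (EuclideanSpace ℝ (Fin d)))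
    [IsFiniteMeasure (volume.restrict A)] (R : ℝ) :
    ∫ z, (Metric.ball (0 : EuclideanSpace ℝ (Fin d)) R).indicator (fun _ => (1 : ℝ)) (z.1 - z.2)
      ∂((volume.restrict A).prod (volume.restrict A)) ≤
    (volume.restrict A).real Set.univ *
      volume.real (Metric.ball (0 : EuclideanSpace ℝ (Fin d)) R) := by
  have hi := integrable_sub_of_bounded (μ := volume.restrict A) (measurable_indicator_ball R)
    (norm_indicator_ball_le (d := d) R)
  rw [integral_prod_symm _ hi, ← smul_eq_mul, ← integral_const]
  refine integral_mono hi.integral_prod_right (integrable_const _) fun y => ?_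
  have e : (fun x => (Metric.ball (0 : EuclideanSpace ℝ (Fin d)) R).indicator (fun _ => (1 : ℝ))
      (x - y)) = (Metric.ball y R).indicator fun _ => (1 : ℝ) := by
    classical
    ext x
    simp [Set.indicator_apply, dist_eq_norm]
  simp only [e]
  refine (integral_indicator_one (μ := volume.restrict A)
    (Metric.isOpen_ball (x := y) (ε := R)).measurableSet).le.trans ?_
  refine (ENNReal.toReal_mono ?_ (Measure.restrict_apply_le _ _)).trans (le_of_eq ?_)
  · exact measure_ball_lt_top.ne
  · rw [measureReal_def, Measure.addHaar_ball_center]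

variable {Δ : Set (EuclideanSpace ℝ (Fin d))} {f g : EuclideanSpace ℝ (Fin d) → ℝ}

/-- Differences of points of the dilated window have norm at most `D r`, so `f ≥ (D r)^(-s)` off the
ball of radius `R`; the pairs inside that ball are discarded. -/
theorem integral_window_ge (hΔ : IsCompact Δ) (hf : Measurable f) (hf0 : ∀ z, 0 ≤ f z)
    (hf1 : ∀ z, f z ≤ 1) {s R : ℝ} (hs : 0 < s) (hR : 0 < R) (hfs : ∀ z, R ≤ ‖z‖ → ‖z‖ ^ (-s) ≤ f z)
    {D : ℝ} (hD : 0 < D) (hΔD : ∀ x ∈ Δ, ∀ y ∈ Δ, ‖x - y‖ ≤ D) {r : ℝ} (hr : 0 < r) :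
    (D * r) ^ (-s) * ((windowMeasure Δ r).real Set.univ ^ 2 - (windowMeasure Δ r).real Set.univ *
      volume.real (Metric.ball (0 : EuclideanSpace ℝ (Fin d)) R)) ≤
    ∫ z, f (z.1 - z.2) ∂((windowMeasure Δ r).prod (windowMeasure Δ r)) := by
  have hfin := isFiniteMeasure_windowMeasure hΔ r
  have hDr : 0 < (D * r) ^ (-s) := by positivity
  set χ := (Metric.ball (0 : EuclideanSpace ℝ (Fin d)) R).indicator fun _ => (1 : ℝ) with hχ
  have iχ := integrable_sub_of_bounded (μ := windowMeasure Δ r) (measurable_indicator_ball R)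
    (norm_indicator_ball_le (d := d) R)
  have i_f := integrable_sub_of_bounded (μ := windowMeasure Δ r) hf (C := 1)
    fun z => by rw [Real.norm_of_nonneg (hf0 z)]; exact hf1 z
  have h1 : ∫ z, χ (z.1 - z.2) ∂((windowMeasure Δ r).prod (windowMeasure Δ r)) ≤
      (windowMeasure Δ r).real Set.univ *
        volume.real (Metric.ball (0 : EuclideanSpace ℝ (Fin d)) R) := by
    unfold windowMeasure at hfin ⊢
    exact integral_indicator_ball_le _ _
  have h2 : ∫ z, (D * r) ^ (-s) * (1 - χ (z.1 - z.2))
      ∂((windowMeasure Δ r).prod (windowMeasure Δ r)) ≤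
      ∫ z, f (z.1 - z.2) ∂((windowMeasure Δ r).prod (windowMeasure Δ r)) := by
    refine integral_mono_ae (((integrable_const 1).sub iχ).const_mul _) i_f ?_
    have hm : MeasurableSet (r • Δ) := (hΔ.smul r).isClosed.measurableSet
    have hae : ∀ᵐ z ∂((windowMeasure Δ r).prod (windowMeasure Δ r)), z ∈ (r • Δ) ×ˢ (r • Δ) := by
      rw [windowMeasure, Measure.prod_restrict]
      exact ae_restrict_mem (hm.prod hm)
    filter_upwards [hae] with z hz
    by_cases hzR : z.1 - z.2 ∈ Metric.ball (0 : EuclideanSpace ℝ (Fin d)) R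
    · simp only [hχ, Set.indicator_of_mem hzR, sub_self, mul_zero]
      exact hf0 _
    · simp only [hχ, Set.indicator_of_notMem hzR, sub_zero, mul_one]
      have hzR' : R ≤ ‖z.1 - z.2‖ := by simpa using hzR
      refine le_trans ?_ (hfs _ hzR')
      obtain ⟨⟨x, hx, hx'⟩, ⟨y, hy, hy'⟩⟩ := hz
      refine Real.rpow_le_rpow_of_nonpos (hR.trans_le hzR') ?_ (by linarith)
      rw [← hx', ← hy']
      simp only
      rw [← smul_sub, norm_smul, Real.norm_of_nonneg hr.le, mul_comm]
      exact mul_le_mul_of_nonneg_right (hΔD x hx y hy) hr.le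
  rw [integral_const_mul, integral_sub (integrable_const 1) iχ, integral_const, smul_eq_mul,
    mul_one, ← Set.univ_prod_univ, measureReal_prod_prod, ← pow_two] at h2
  refine le_trans (mul_le_mul_of_nonneg_left ?_ hDr.le) h2
  linarith

/-- Off a large ball `g` is at most a small multiple of `f`; inside it, `g ≤ C` contributes only
`O(V r)`. This is negligible since the integral of `f` grows faster than the volume `V r`. -/
theorem tendsto_window_ratio (hΔ : IsCompact Δ) (hvol : 0 < volume.real Δ)
    (hf : Measurable f) (hf0 : ∀ z, 0 ≤ f z)
    (hf1 : ∀ z, f z ≤ 1) {s R : ℝ} (hs : 0 < s) (hsd : s < d) (hR : 0 < R)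
    (hfs : ∀ z, R ≤ ‖z‖ → ‖z‖ ^ (-s) ≤ f z) (hg : Measurable g) (hg0 : ∀ z, 0 ≤ g z) {C : ℝ}
    (hgC : ∀ z, g z ≤ C) (hgf : ∀ ε, 0 < ε → ∃ R', ∀ z, R' ≤ ‖z‖ → g z ≤ ε * f z) :
    Tendsto (fun r => (∫ z, g (z.1 - z.2) ∂((windowMeasure Δ r).prod (windowMeasure Δ r))) /
      ∫ z, f (z.1 - z.2) ∂((windowMeasure Δ r).prod (windowMeasure Δ r))) atTop (𝓝 0) := by
  obtain ⟨D, hD, hΔD⟩ : ∃ D, 0 < D ∧ ∀ x ∈ Δ, ∀ y ∈ Δ, ‖x - y‖ ≤ D := by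
    obtain ⟨D, hD⟩ := Metric.isBounded_iff.1 hΔ.isBounded
    exact ⟨max D 1, by positivity, fun x hx y hy => by
      rw [← dist_eq_norm]; exact (hD hx hy).trans (le_max_left _ _)⟩
  set V : ℝ → ℝ := fun r => (windowMeasure Δ r).real Set.univ with hV
  set I : ℝ → ℝ := fun r => ∫ z, f (z.1 - z.2) ∂((windowMeasure Δ r).prod (windowMeasure Δ r))
    with hI
  set B := volume.real (Metric.ball (0 : EuclideanSpace ℝ (Fin d)) R) with hB
  -- The leading term is a positive multiple of `r^(d-s)`; this is where `s < d` enters.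
  have hlim : Tendsto (fun r => (D * r) ^ (-s) * (V r - B)) atTop atTop := by
    have l1 : Tendsto (fun r : ℝ => D ^ (-s) * (volume.real Δ * r ^ ((d : ℝ) - s) + -B * r ^ (-s)))
        atTop atTop := by
      refine Tendsto.const_mul_atTop (by positivity) ?_
      exact ((tendsto_rpow_atTop (by linarith)).const_mul_atTop hvol).atTop_add
        ((tendsto_rpow_neg_atTop hs).const_mul (-B))
    refine l1.congr' ?_
    filter_upwards [eventually_gt_atTop 0] with r hr
    simp only [hV]
    rw [windowMeasure_real_univ Δ hr, Real.mul_rpow hD.le hr.le, sub_eq_add_neg (d : ℝ) s,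
      Real.rpow_add hr, Real.rpow_natCast]
    ring
  have hVI : ∀ᶠ r in atTop, 0 < V r ∧ 0 < I r ∧ V r / I r ≤ ((D * r) ^ (-s) * (V r - B))⁻¹ := by
    filter_upwards [eventually_gt_atTop 0, hlim.eventually_gt_atTop 0] with r hr hr2
    have hVpos : 0 < V r := by
      simp only [hV]
      rw [windowMeasure_real_univ Δ hr]
      positivity
    have h1 := integral_window_ge hΔ hf hf0 hf1 hs hR hfs hD hΔD hr
    have h2 : V r * ((D * r) ^ (-s) * (V r - B)) ≤ I r := by
      refine le_trans (le_of_eq ?_) h1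
      simp only [hV, hB]
      ring
    have hIpos : 0 < I r := lt_of_lt_of_le (mul_pos hVpos hr2) h2
    refine ⟨hVpos, hIpos, ?_⟩
    rw [div_le_iff₀ hIpos, ← div_eq_inv_mul, le_div_iff₀ hr2]
    exact h2
  have hq : Tendsto (fun r => V r / I r) atTop (𝓝 0) := by
    refine squeeze_zero' ?_ ?_ hlim.inv_tendsto_atTop
    · filter_upwards [hVI] with r h using (div_pos h.1 h.2.1).le
    · filter_upwards [hVI] with r h using h.2.2
  have hC : 0 ≤ C := (hg0 0).trans (hgC 0)
  rw [Metric.tendsto_nhds]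
  intro ε hε
  obtain ⟨R', hR'⟩ := hgf (ε / 2) (half_pos hε)
  set B' := volume.real (Metric.ball (0 : EuclideanSpace ℝ (Fin d)) R') with hB'
  have hq' := (hq.const_mul (C * B')).eventually_lt_const
    (show C * B' * 0 < ε / 2 by rw [mul_zero]; exact half_pos hε)
  filter_upwards [hVI, hq'] with r h1 h2
  have hfin := isFiniteMeasure_windowMeasure hΔ r
  rw [Real.dist_0_eq_abs, abs_of_nonneg (div_nonneg (integral_nonneg fun _ => hg0 _) h1.2.1.le),
    div_lt_iff₀ h1.2.1]
  have iχ := integrable_sub_of_bounded (μ := windowMeasure Δ r) (measurable_indicator_ball R')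
    (norm_indicator_ball_le (d := d) R')
  have i_f := integrable_sub_of_bounded (μ := windowMeasure Δ r) hf (C := 1)
    fun z => by rw [Real.norm_of_nonneg (hf0 z)]; exact hf1 z
  have i_g := integrable_sub_of_bounded (μ := windowMeasure Δ r) hg (C := C)
    fun z => by rw [Real.norm_of_nonneg (hg0 z)]; exact hgC z
  have hb : ∫ z, (Metric.ball (0 : EuclideanSpace ℝ (Fin d)) R').indicator (fun _ => (1 : ℝ))
      (z.1 - z.2) ∂((windowMeasure Δ r).prod (windowMeasure Δ r)) ≤ V r * B' := by
    simp only [hV]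
    unfold windowMeasure at hfin ⊢
    exact integral_indicator_ball_le _ _
  have hle : ∫ z, g (z.1 - z.2) ∂((windowMeasure Δ r).prod (windowMeasure Δ r)) ≤
      ε / 2 * I r + C * (V r * B') := by
    refine le_trans ?_ (add_le_add_right (mul_le_mul_of_nonneg_left hb hC) _)
    rw [hI, ← integral_const_mul, ← integral_const_mul, ← integral_add (i_f.const_mul _)
      (iχ.const_mul _)]
    refine integral_mono i_g ((i_f.const_mul _).add (iχ.const_mul _)) fun z => ?_
    by_cases hz : z.1 - z.2 ∈ Metric.ball (0 : EuclideanSpace ℝ (Fin d)) R'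
    · rw [Set.indicator_of_mem hz, mul_one]
      have := mul_nonneg (half_pos hε).le (hf0 (z.1 - z.2))
      linarith [hgC (z.1 - z.2)]
    · rw [Set.indicator_of_notMem hz, mul_zero, add_zero]
      exact hR' _ (by simpa using hz)
  have h3 : C * B' * (V r / I r) * I r = C * (V r * B') := by
    have := h1.2.1.ne'
    field_simp
  have h4 := mul_lt_mul_of_pos_right h2 h1.2.1
  rw [h3] at h4
  linarith

end Windows

/-! ### Multi-indices of minimal decay exponent. -/

section Weights

variable {m n : ℕ} {α β : ℝ} {κ : ℕ} {G : (Fin m ⊕ Fin n → ℝ) → ℝ}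

theorem mem_Nplus_iff {v : Fin m ⊕ Fin n → ℕ} :
    v ∈ Nplus G κ ↔ hermiteCoeff G v ≠ 0 ∧
      κ ≤ ∑ j, v (Sum.inl j) + ∑ j, v (Sum.inr j) := by
  simp only [Nplus, Set.mem_ofPred_eq, mem_multiIndices, Fintype.sum_sum_type]
  exact and_congr_right fun _ => ⟨fun ⟨l, h1, h2⟩ => h2 ▸ h1, fun h => ⟨_, h, rfl⟩⟩

theorem weight_eq (v : Fin m ⊕ Fin n → ℕ) : weight α β v =
    β * ((∑ j, v (Sum.inl j) : ℕ) : ℝ) + α * ((∑ j, v (Sum.inr j) : ℕ) : ℝ) := by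
  simp [weight]

/-- Any exponent is at least `α` times the order, hence at least `ακ`; the multi-index in `hv`
attains this. -/
theorem minWeight_eq (hα : 0 < α) (hαβ : α < β)
    (hv : ∃ v ∈ multiIndices (Fin m ⊕ Fin n) κ, v ∈ Nplus G κ ∧ ∑ j : Fin n, v (Sum.inr j) = κ) :
    minWeight G κ α β = α * κ := by
  refine IsLeast.csInf_eq ⟨?_, ?_⟩
  · obtain ⟨v, h1, h2, h3⟩ := hv
    refine ⟨v, h2, ?_⟩
    rw [mem_multiIndices, Fintype.sum_sum_type, h3] at h1
    rw [weight_eq, h3, show ∑ j, v (Sum.inl j) = 0 by omega]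
    simp
  · rintro _ ⟨v, hv, rfl⟩
    rw [weight_eq]
    have h : (κ : ℝ) ≤ ((∑ j, v (Sum.inl j) : ℕ) : ℝ) + ((∑ j, v (Sum.inr j) : ℕ) : ℝ) := by
      exact_mod_cast (mem_Nplus_iff.1 hv).2
    have h0 : (0 : ℝ) ≤ ((∑ j, v (Sum.inl j) : ℕ) : ℝ) := Nat.cast_nonneg _
    nlinarith [mul_nonneg (sub_nonneg.2 hαβ.le) h0, mul_nonneg hα.le (sub_nonneg.2 h)]

theorem mem_Nstar_iff (hα : 0 < α) (hαβ : α < β)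
    (hv : ∃ v ∈ multiIndices (Fin m ⊕ Fin n) κ, v ∈ Nplus G κ ∧ ∑ j : Fin n, v (Sum.inr j) = κ)
    {v : Fin m ⊕ Fin n → ℕ} :
    v ∈ Nstar G κ α β κ ↔
      hermiteCoeff G v ≠ 0 ∧ ∑ j, v (Sum.inl j) = 0 ∧ ∑ j, v (Sum.inr j) = κ := by
  classical
  simp only [Nstar, Finset.mem_filter, mem_multiIndices, Fintype.sum_sum_type, mem_Nplus_iff,
    minWeight_eq hα hαβ hv, weight_eq]
  constructor
  · rintro ⟨h1, ⟨h2, -⟩, h3⟩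
    have e : (κ : ℝ) = ((∑ j, v (Sum.inl j) : ℕ) : ℝ) + ((∑ j, v (Sum.inr j) : ℕ) : ℝ) := by
      rw [← h1]
      push_cast
      rfl
    have h4 : (β - α) * ((∑ j, v (Sum.inl j) : ℕ) : ℝ) = 0 := by
      rw [e] at h3
      linarith
    have h5 : ∑ j, v (Sum.inl j) = 0 := by
      exact_mod_cast (mul_eq_zero.1 h4).resolve_left (sub_pos.2 hαβ).ne'
    exact ⟨h2, h5, by omega⟩
  · rintro ⟨h1, h2, h3⟩
    rw [h2, h3]
    refine ⟨by omega, ⟨h1, by omega⟩, by simp⟩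

end Weights

/-! ### Correlation functions and their comparison at infinity. -/

section Correlation

variable {d m n : ℕ} {α β : ℝ} {L L₁ L₂ : ℝ → ℝ}

/-- The correlation function `‖x‖^(-α) L(‖x‖)`, with value `1` at the origin. -/
noncomputable def corr (α : ℝ) (L : ℝ → ℝ) (x : EuclideanSpace ℝ (Fin d)) : ℝ :=
  open Classical in if x = 0 then 1 else ‖x‖ ^ (-α) * L ‖x‖

theorem covMatrix_inl (x : EuclideanSpace ℝ (Fin d)) (j : Fin m) :
    covMatrix m n α β L₁ L₂ x (Sum.inl j) (Sum.inl j) = corr β L₁ x := by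
  unfold covMatrix corr
  split_ifs <;> simp

theorem covMatrix_inr (x : EuclideanSpace ℝ (Fin d)) (j : Fin n) :
    covMatrix m n α β L₁ L₂ x (Sum.inr j) (Sum.inr j) = corr α L₂ x := by
  unfold covMatrix corr
  split_ifs <;> simp

theorem covProd_eq (v : Fin m ⊕ Fin n → ℕ) (x : EuclideanSpace ℝ (Fin d)) :
    covProd α β L₁ L₂ v x =
      corr β L₁ x ^ (∑ j, v (Sum.inl j)) * corr α L₂ x ^ (∑ j, v (Sum.inr j)) := by
  simp only [covProd, Fintype.prod_sum_type, covMatrix_inl, covMatrix_inr,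
    Finset.prod_pow_eq_pow_sum]

theorem SlowlyVarying.corr_pos (hL : SlowlyVarying L) (x : EuclideanSpace ℝ (Fin d)) :
    0 < corr α L x := by
  unfold corr
  split_ifs with h
  · exact one_pos
  · have := norm_pos_iff.2 h
    exact mul_pos (Real.rpow_pos_of_pos this _) (hL.pos _ this)

/-- Measurability of `L` is known only on `(0,∞)`, so the origin is split off. -/
theorem SlowlyVarying.measurable_corr (hL : SlowlyVarying L) :
    Measurable (corr α L : EuclideanSpace ℝ (Fin d) → ℝ) := by
  refine measurable_of_measurable_on_compl_singleton 0 ?_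
  have h : Measurable fun x : {x : EuclideanSpace ℝ (Fin d) | x ≠ 0} =>
      (⟨‖(x : EuclideanSpace ℝ (Fin d))‖, norm_pos_iff.2 x.2⟩ : Set.Ioi (0 : ℝ)) :=
    (measurable_norm.comp measurable_subtype_coe).subtype_mk
  have h2 : Measurable fun x : {x : EuclideanSpace ℝ (Fin d) | x ≠ 0} =>
      ‖(x : EuclideanSpace ℝ (Fin d))‖ ^ (-α) * L ‖(x : EuclideanSpace ℝ (Fin d))‖ :=
    ((measurable_norm.comp measurable_subtype_coe).pow_const (-α)).mul (hL.measurable.comp h)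
  convert h2 using 1
  ext x
  exact if_neg x.2

theorem corr_eq_of_pos {x : EuclideanSpace ℝ (Fin d)} (hx : 0 < ‖x‖) :
    corr α L x = ‖x‖ ^ (-α) * L ‖x‖ :=
  if_neg (norm_pos_iff.1 hx)

/-- The comparison of the strongly and the weakly dependent correlations at infinity. -/
theorem exists_corr_bounds (hL₁ : SlowlyVarying L₁) (hL₂ : SlowlyVarying L₂) {κ : ℕ} (hκ : 1 ≤ κ)
    (hα : 0 < α) (hακ : α * κ < d) (hβ : (d : ℝ) < β) :
    (∃ s R : ℝ, 0 < s ∧ s < d ∧ 0 < R ∧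
      ∀ z : EuclideanSpace ℝ (Fin d), R ≤ ‖z‖ → ‖z‖ ^ (-s) ≤ corr α L₂ z ^ κ) ∧
    ∀ ε : ℝ, 0 < ε → ∃ R : ℝ, ∀ z : EuclideanSpace ℝ (Fin d), R ≤ ‖z‖ →
      corr β L₁ z + corr α L₂ z ^ (κ + 1) ≤ ε * corr α L₂ z ^ κ := by
  have hκ0 : (0 : ℝ) < κ := by exact_mod_cast hκ
  -- `δ ≤ α/2` keeps `ρ₂ ≤ t^(-α/2)`, while the second bound gives `s + δ = ακ + δ(κ+1) < d < β`. So
  -- `s < d`, and `ρ₁` decays faster than `t^(-s) ≤ ρ₂^κ`.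
  set δ := min (α / 2) ((d - α * κ) / (2 * (κ + 1))) with hδ
  have hδ0 : 0 < δ := lt_min (half_pos hα) (div_pos (by linarith) (by positivity))
  have hδ1 : δ ≤ α / 2 := min_le_left _ _
  have hδ2 : δ * (κ + 1) ≤ (d - α * κ) / 2 := by
    have : δ ≤ (d - α * κ) / (2 * (κ + 1)) := min_le_right _ _
    rw [le_div_iff₀ (by positivity)] at this
    linarith
  set s := (α + δ) * κ with hs
  have hs0 : 0 < s := by positivity
  have hsd : s + δ < d := by rw [hs]; linarith
  have hbase : ∀ᶠ t in atTop, 0 < t ∧ t ^ (-s) ≤ (t ^ (-α) * L₂ t) ^ κ ∧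
      t ^ (-α) * L₂ t ≤ t ^ (-(α / 2)) ∧ t ^ (-β) * L₁ t ≤ t ^ (-(β - δ - s)) * t ^ (-s) := by
    filter_upwards [hL₁.eventually_rpow_le hδ0, hL₂.eventually_rpow_le hδ0, eventually_ge_atTop 1]
      with t h1 h2 h3
    have ht : 0 < t := by linarith
    refine ⟨ht, ?_, ?_, ?_⟩
    · have : t ^ (-s) = (t ^ (-α) * t ^ (-δ)) ^ κ := by
        rw [← Real.rpow_add ht, ← Real.rpow_natCast, ← Real.rpow_mul ht.le, hs]
        congr 1
        ring
      rw [this]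
      exact pow_le_pow_left₀ (by positivity) (mul_le_mul_of_nonneg_left h2.1 (by positivity)) κ
    · refine (mul_le_mul_of_nonneg_left h2.2 (by positivity)).trans ?_
      rw [← Real.rpow_add ht]
      exact Real.rpow_le_rpow_of_exponent_le h3 (by linarith)
    · refine (mul_le_mul_of_nonneg_left h1.2 (by positivity)).trans (le_of_eq ?_)
      rw [← Real.rpow_add ht, ← Real.rpow_add ht]
      congr 1
      ring
  refine ⟨?_, fun ε hε => ?_⟩
  · obtain ⟨R, hR⟩ := eventually_atTop.1 hbase
    refine ⟨s, max R 1, hs0, by linarith, by positivity, fun z hz => ?_⟩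
    have h := hR ‖z‖ ((le_max_left _ _).trans hz)
    rw [corr_eq_of_pos h.1]
    exact h.2.1
  · have l1 := (tendsto_rpow_neg_atTop (show 0 < α / 2 by linarith)).eventually_le_const
      (half_pos hε)
    have l2 := (tendsto_rpow_neg_atTop (show 0 < β - δ - s by linarith)).eventually_le_const
      (half_pos hε)
    obtain ⟨R, hR⟩ := eventually_atTop.1 (hbase.and (l1.and l2))
    refine ⟨R, fun z hz => ?_⟩
    obtain ⟨⟨h0, h1, h2, h3⟩, h4, h5⟩ := hR ‖z‖ hz
    rw [corr_eq_of_pos h0, corr_eq_of_pos h0]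
    have hpos : 0 < ‖z‖ ^ (-s) := by positivity
    have a1 : ‖z‖ ^ (-β) * L₁ ‖z‖ ≤ ε / 2 * (‖z‖ ^ (-α) * L₂ ‖z‖) ^ κ :=
      h3.trans (mul_le_mul h5 h1 hpos.le (half_pos hε).le)
    have a2 : (‖z‖ ^ (-α) * L₂ ‖z‖) ^ (κ + 1) ≤ ε / 2 * (‖z‖ ^ (-α) * L₂ ‖z‖) ^ κ := by
      rw [pow_succ, mul_comm]
      exact mul_le_mul_of_nonneg_right (h2.trans h4) (hpos.le.trans h1)
    linarith

end Correlation

/-! ### Leading and negligible Hermite components. -/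

section Functionals

variable {d m n : ℕ} {Ω : Type*} [MeasurableSpace Ω] {P : Measure Ω} [IsProbabilityMeasure P]
  {α β : ℝ} {L₁ L₂ : ℝ → ℝ} {η : EuclideanSpace ℝ (Fin d) → Ω → (Fin m ⊕ Fin n → ℝ)}
  {Δ : Set (EuclideanSpace ℝ (Fin d))} {κ : ℕ} {G : (Fin m ⊕ Fin n → ℝ) → ℝ}

theorem hermiteProd_zero {ι : Type*} [Fintype ι] (w : ι → ℝ) : hermiteProd 0 w = 1 := by
  simp [hermiteProd]

theorem integral_eq_hermiteCoeff_zero {ι : Type*} [Fintype ι] (F : (ι → ℝ) → ℝ) :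
    ∫ w, F w ∂(stdGauss ι) = hermiteCoeff F 0 := by
  simp [hermiteCoeff, hermiteProd_zero]

theorem IsStrongWeakField.hermiteSum_ae (hη : IsStrongWeakField P α β L₁ L₂ η) (hΔ : IsCompact Δ)
    (S : Finset (Fin m ⊕ Fin n → ℕ)) (r : ℝ) :
    fieldIntegral η (windowMeasure Δ r) (hermitePartial G S) =ᵐ[P] hermiteSum Δ G η S r := by
  have := isFiniteMeasure_windowMeasure hΔ r
  exact fieldIntegral_hermitePartial_ae hη.measurable hη.map_eq_stdGauss (windowMeasure Δ r) G S

theorem IsStrongWeakField.corr_inl_le_one (hη : IsStrongWeakField P α β L₁ L₂ η) (hm : 0 < m)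
    (x : EuclideanSpace ℝ (Fin d)) : corr β L₁ x ≤ 1 := by
  rw [← covMatrix_inl (n := n) (α := α) (L₂ := L₂) x ⟨0, hm⟩]
  exact hη.covMatrix_le_one x _

theorem IsStrongWeakField.corr_inr_le_one (hη : IsStrongWeakField P α β L₁ L₂ η) (hn : 0 < n)
    (x : EuclideanSpace ℝ (Fin d)) : corr α L₂ x ≤ 1 := by
  rw [← covMatrix_inr (m := m) (β := β) (L₁ := L₁) x ⟨0, hn⟩]
  exact hη.covMatrix_le_one x _

theorem covProd_nonneg (hL₁ : SlowlyVarying L₁) (hL₂ : SlowlyVarying L₂)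
    (v : Fin m ⊕ Fin n → ℕ) (x : EuclideanSpace ℝ (Fin d)) : 0 ≤ covProd α β L₁ L₂ v x := by
  rw [covProd_eq]
  exact mul_nonneg (pow_nonneg (hL₁.corr_pos x).le _) (pow_nonneg (hL₂.corr_pos x).le _)

/-- The majorant of the covariances of the negligible Hermite components. -/
noncomputable def majorant (α β : ℝ) (L₁ L₂ : ℝ → ℝ) (κ : ℕ) (x : EuclideanSpace ℝ (Fin d)) : ℝ :=
  min 1 (corr β L₁ x) + corr α L₂ x ^ (κ + 1)

/-- All factors of the kernel are at most `1`, so one factor `ρ₁`, or `κ + 1` factors `ρ₂`,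
suffices. If `m = 0`, `ρ₁` is the correlation of no component and may exceed `1`; the truncation in
`majorant` keeps the bound finite near the origin. -/
theorem covProd_le_majorant (hη : IsStrongWeakField P α β L₁ L₂ η) (hn : 0 < n)
    (hL₁ : SlowlyVarying L₁) (hL₂ : SlowlyVarying L₂) {v : Fin m ⊕ Fin n → ℕ}
    (hv : ∑ j, v (Sum.inl j) ≠ 0 ∨ κ + 1 ≤ ∑ j, v (Sum.inr j)) (x : EuclideanSpace ℝ (Fin d)) :
    covProd α β L₁ L₂ v x ≤ majorant α β L₁ L₂ κ x := by
  have p1 := hL₁.corr_pos (α := β) x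
  have p2 := hL₂.corr_pos (α := α) x
  have h2 := hη.corr_inr_le_one hn x
  have nn : 0 ≤ min 1 (corr β L₁ x) := le_min zero_le_one p1.le
  rw [covProd_eq, majorant]
  by_cases h0 : ∑ j, v (Sum.inl j) = 0
  · rw [h0, pow_zero, one_mul]
    have := pow_le_pow_of_le_one p2.le h2 (hv.resolve_left (not_not.2 h0))
    linarith
  · have hm : 0 < m := by
      rcases Nat.eq_zero_or_pos m with rfl | hm
      · simp at h0
      · exact hm
    have h1 := hη.corr_inl_le_one hm x
    rw [min_eq_right h1]
    have a : corr β L₁ x ^ (∑ j, v (Sum.inl j)) ≤ corr β L₁ x := pow_le_of_le_one p1.le h1 h0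
    have b : corr α L₂ x ^ (∑ j, v (Sum.inr j)) ≤ 1 := pow_le_one₀ p2.le h2
    have c := mul_le_mul a b (pow_nonneg p2.le _) p1.le
    have := pow_nonneg p2.le (κ + 1)
    linarith

theorem measurable_covProd (hL₁ : SlowlyVarying L₁) (hL₂ : SlowlyVarying L₂)
    (v : Fin m ⊕ Fin n → ℕ) :
    Measurable (covProd α β L₁ L₂ v : EuclideanSpace ℝ (Fin d) → ℝ) := by
  have : (covProd α β L₁ L₂ v : EuclideanSpace ℝ (Fin d) → ℝ) = _ := funext (covProd_eq v)
  rw [this]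
  exact (hL₁.measurable_corr.pow_const _).mul (hL₂.measurable_corr.pow_const _)

theorem IsStrongWeakField.covProd_le_one (hη : IsStrongWeakField P α β L₁ L₂ η)
    (hL₁ : SlowlyVarying L₁) (hL₂ : SlowlyVarying L₂) (v : Fin m ⊕ Fin n → ℕ)
    (x : EuclideanSpace ℝ (Fin d)) : covProd α β L₁ L₂ v x ≤ 1 := by
  refine Finset.prod_le_one (fun j _ => pow_nonneg ?_ _)
    fun j _ => pow_le_one₀ ?_ (hη.covMatrix_le_one x j)
  all_goals
    cases j
    · rw [covMatrix_inl]
      exact (hL₁.corr_pos x).le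
    · rw [covMatrix_inr]
      exact (hL₂.corr_pos x).le

theorem IsStrongWeakField.hasSum_sq (hη : IsStrongWeakField P α β L₁ L₂ η) (hΔ : IsCompact Δ)
    (r : ℝ) {F : (Fin m ⊕ Fin n → ℝ) → ℝ} (hF : MemLp F 2 (stdGauss (Fin m ⊕ Fin n))) :
    HasSum (fun v => hermiteCoeff F v ^ 2 / (multiFactorial v : ℝ) *
        ∫ z, covProd α β L₁ L₂ v (z.1 - z.2) ∂((windowMeasure Δ r).prod (windowMeasure Δ r)))
      (∫ ω, fieldIntegral η (windowMeasure Δ r) F ω ^ 2 ∂P) := by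
  have := isFiniteMeasure_windowMeasure hΔ r
  exact hasSum_integral_fieldIntegral_sq hη.measurable hη.map_eq_stdGauss (windowMeasure Δ r)
    (c := fun v z => covProd α β L₁ L₂ v (z.1 - z.2)) hη.integral_hermiteProd_mul hF

/-- Functionals whose Hermite expansion avoids the leading terms are bounded by the majorant. -/
theorem integral_fieldIntegral_sq_le_majorant (hη : IsStrongWeakField P α β L₁ L₂ η)
    (hΔ : IsCompact Δ) (hn : 0 < n) (hL₁ : SlowlyVarying L₁) (hL₂ : SlowlyVarying L₂) (r : ℝ)
    {F : (Fin m ⊕ Fin n → ℝ) → ℝ} (hF : MemLp F 2 (stdGauss (Fin m ⊕ Fin n)))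
    (hc : ∀ v, hermiteCoeff F v ≠ 0 → ∑ j, v (Sum.inl j) ≠ 0 ∨ κ + 1 ≤ ∑ j, v (Sum.inr j)) :
    ∫ ω, fieldIntegral η (windowMeasure Δ r) F ω ^ 2 ∂P ≤
      (∫ w, F w ^ 2 ∂(stdGauss (Fin m ⊕ Fin n))) *
        ∫ z, majorant α β L₁ L₂ κ (z.1 - z.2)
          ∂((windowMeasure Δ r).prod (windowMeasure Δ r)) := by
  have := isFiniteMeasure_windowMeasure hΔ r
  -- Termwise comparison with the Parseval series of `F`.
  refine hasSum_le (fun v => ?_) (hη.hasSum_sq hΔ r hF)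
    ((hasSum_hermiteCoeff_sq hF).mul_right _)
  by_cases h0 : hermiteCoeff F v = 0
  · simp [h0]
  · refine mul_le_mul_of_nonneg_left ?_ (div_nonneg (sq_nonneg _) (multiFactorial_pos v).le)
    refine integral_mono ?_ ?_ fun z => covProd_le_majorant hη hn hL₁ hL₂ (hc v h0) _
    · refine integrable_sub_of_bounded (measurable_covProd hL₁ hL₂ v) (C := 1) fun z => ?_
      rw [Real.norm_of_nonneg (covProd_nonneg hL₁ hL₂ v z)]
      exact hη.covProd_le_one hL₁ hL₂ v z
    · refine integrable_sub_of_bounded ?_ (C := 2) fun z => ?_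
      · exact (measurable_const.min hL₁.measurable_corr).add (hL₂.measurable_corr.pow_const _)
      · have p1 := hL₁.corr_pos (α := β) z
        have p2 := hL₂.corr_pos (α := α) z
        have b : corr α L₂ z ^ (κ + 1) ≤ 1 := pow_le_one₀ p2.le (hη.corr_inr_le_one hn z)
        rw [majorant, Real.norm_of_nonneg (by positivity)]
        linarith [min_le_left 1 (corr β L₁ z)]

/-- The leading terms bound the second moment from below. -/
theorem le_integral_fieldIntegral_sq (hη : IsStrongWeakField P α β L₁ L₂ η)
    (hΔ : IsCompact Δ) (hL₁ : SlowlyVarying L₁) (hL₂ : SlowlyVarying L₂) (r : ℝ)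
    {F : (Fin m ⊕ Fin n → ℝ) → ℝ} (hF : MemLp F 2 (stdGauss (Fin m ⊕ Fin n)))
    {T : Finset (Fin m ⊕ Fin n → ℕ)}
    (hT : ∀ v ∈ T, ∑ j, v (Sum.inl j) = 0 ∧ ∑ j, v (Sum.inr j) = κ)
    (hc : ∀ v ∈ T, hermiteCoeff F v = hermiteCoeff G v) :
    (∑ v ∈ T, hermiteCoeff G v ^ 2 / (multiFactorial v : ℝ)) *
      ∫ z, corr α L₂ (z.1 - z.2) ^ κ ∂((windowMeasure Δ r).prod (windowMeasure Δ r)) ≤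
    ∫ ω, fieldIntegral η (windowMeasure Δ r) F ω ^ 2 ∂P := by
  -- On `T` every kernel equals `ρ₂^κ`; the other terms of the series are nonnegative and are
  -- dropped.
  refine le_trans (le_of_eq ?_) (sum_le_hasSum T (fun v _ => ?_) (hη.hasSum_sq hΔ r hF))
  · rw [Finset.sum_mul]
    refine Finset.sum_congr rfl fun v hv => ?_
    simp only [covProd_eq, hc v hv, (hT v hv).1, (hT v hv).2, pow_zero, one_mul]
  · exact mul_nonneg (div_nonneg (sq_nonneg _) (multiFactorial_pos v).le)
      (integral_nonneg fun z => covProd_nonneg hL₁ hL₂ v _)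

theorem integral_corr_pow_pos (hη : IsStrongWeakField P α β L₁ L₂ η) (hn : 0 < n)
    (hL₂ : SlowlyVarying L₂) (hΔ : IsCompact Δ) (hvol : 0 < volume.real Δ) {r : ℝ} (hr : 0 < r) :
    0 < ∫ z, corr α L₂ (z.1 - z.2) ^ κ ∂((windowMeasure Δ r).prod (windowMeasure Δ r)) := by
  have := isFiniteMeasure_windowMeasure hΔ r
  have hne : windowMeasure Δ r ≠ 0 := by
    intro h
    have := windowMeasure_real_univ Δ hr
    rw [h] at this
    have hp : 0 < r ^ d * volume.real Δ := by positivity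
    rw [← this] at hp
    simp at hp
  have : NeZero (windowMeasure Δ r) := ⟨hne⟩
  have hi : Integrable (fun z : EuclideanSpace ℝ (Fin d) × EuclideanSpace ℝ (Fin d) =>
      corr α L₂ (z.1 - z.2) ^ κ) ((windowMeasure Δ r).prod (windowMeasure Δ r)) := by
    refine integrable_sub_of_bounded (f := fun z => corr α L₂ z ^ κ)
      (hL₂.measurable_corr.pow_const κ) (C := 1) fun z => ?_
    rw [Real.norm_of_nonneg (pow_nonneg (hL₂.corr_pos z).le _)]
    exact pow_le_one₀ (hL₂.corr_pos z).le (hη.corr_inr_le_one hn z)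
  rw [integral_pos_iff_support_of_nonneg (fun z => pow_nonneg (hL₂.corr_pos _).le _) hi]
  have : (Function.support fun z : EuclideanSpace ℝ (Fin d) × EuclideanSpace ℝ (Fin d) =>
      corr α L₂ (z.1 - z.2) ^ κ) = Set.univ := by
    rw [Set.eq_univ_iff_forall]
    exact fun z => (pow_pos (hL₂.corr_pos _) _).ne'
  rw [this, ← Set.univ_prod_univ, Measure.prod_prod]
  have h0 : windowMeasure Δ r Set.univ ≠ 0 := by simpa using hne
  exact pos_iff_ne_zero.2 (mul_ne_zero h0 h0)

theorem tendsto_majorant_ratio (hη : IsStrongWeakField P α β L₁ L₂ η) (hn : 0 < n)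
    (hL₁ : SlowlyVarying L₁) (hL₂ : SlowlyVarying L₂) (hΔ : IsCompact Δ)
    (hvol : 0 < volume.real Δ) (hκ : 1 ≤ κ)
    (hα : 0 < α) (hακ : α * κ < d) (hβ : (d : ℝ) < β) :
    Tendsto (fun r => (∫ z, majorant α β L₁ L₂ κ (z.1 - z.2)
        ∂((windowMeasure Δ r).prod (windowMeasure Δ r))) /
      ∫ z, corr α L₂ (z.1 - z.2) ^ κ ∂((windowMeasure Δ r).prod (windowMeasure Δ r)))
      atTop (𝓝 0) := by
  obtain ⟨⟨s, R, hs, hsd, hR, hfs⟩, hgf⟩ :=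
    exists_corr_bounds (d := d) hL₁ hL₂ hκ hα hακ hβ
  have p1 (z : EuclideanSpace ℝ (Fin d)) := hL₁.corr_pos (α := β) z
  have p2 (z : EuclideanSpace ℝ (Fin d)) := hL₂.corr_pos (α := α) z
  have q2 (k : ℕ) (z : EuclideanSpace ℝ (Fin d)) : corr α L₂ z ^ k ≤ 1 :=
    pow_le_one₀ (p2 z).le (hη.corr_inr_le_one hn z)
  refine tendsto_window_ratio (f := fun z => corr α L₂ z ^ κ) (g := majorant α β L₁ L₂ κ) hΔ hvol
    (hL₂.measurable_corr.pow_const κ) (fun z => pow_nonneg (p2 z).le _) (q2 κ) hs hsd hR hfs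
    ((measurable_const.min hL₁.measurable_corr).add (hL₂.measurable_corr.pow_const _))
    (fun z => ?_) (C := 2) (fun z => ?_) fun ε hε => ?_
  · have := p1 z
    have := p2 z
    rw [majorant]
    positivity
  · rw [majorant]
    linarith [min_le_left 1 (corr β L₁ z), q2 (κ + 1) z]
  · obtain ⟨R', hR'⟩ := hgf ε hε
    refine ⟨R', fun z hz => le_trans ?_ (hR' z hz)⟩
    rw [majorant]
    linarith [min_le_right 1 (corr β L₁ z)]

end Functionals

end StrongWeak

/-! ### The main theorem. -/

open StrongWeak
theorem theorem1 {d m n : ℕ} {Ω : Type*} [MeasurableSpace Ω] (P : Measure Ω) [IsProbabilityMeasure P]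
    (Δ : Set (EuclideanSpace ℝ (Fin d))) (hΔ : IsWindow Δ)
    (κ : ℕ) (α β : ℝ) (hα : 0 < α) (hακ : α < d / κ) (hβ : (d : ℝ) < β)
    (L₁ L₂ : ℝ → ℝ) (hL₁ : SlowlyVarying L₁) (hL₂ : SlowlyVarying L₂)
    (η : EuclideanSpace ℝ (Fin d) → Ω → (Fin m ⊕ Fin n → ℝ))
    (hη : IsStrongWeakField P α β L₁ L₂ η)
    (G : (Fin m ⊕ Fin n → ℝ) → ℝ) (hG : MemLp G 2 (stdGauss (Fin m ⊕ Fin n)))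
    (hG₀ : ∫ w, G w ∂(stdGauss (Fin m ⊕ Fin n)) = 0)
    (hκ : IsHermiteRank G κ)
    (hv : ∃ v ∈ multiIndices (Fin m ⊕ Fin n) κ, v ∈ Nplus G κ ∧ ∑ j : Fin n, v (Sum.inr j) = κ) :
    -- for every `r > 0` the integrals and the normalizations are well defined
    (∀ r : ℝ, 0 < r →
      (∀ᵐ ω ∂P, IntegrableOn (fun x => G (η x ω)) (r • Δ)) ∧
      (∀ v : Fin m ⊕ Fin n → ℕ, ∀ᵐ ω ∂P, IntegrableOn (fun x => hermiteProd v (η x ω)) (r • Δ)) ∧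
      (MemLp (K Δ G η r) 2 P ∧ 0 < variance (K Δ G η r) P) ∧
      (MemLp (Krank Δ G η κ r) 2 P ∧ 0 < variance (Krank Δ G η κ r) P) ∧
      (MemLp (Kstar Δ G η κ α β κ r) 2 P ∧ 0 < variance (Kstar Δ G η κ α β κ r) P)) ∧
    -- the limit laws
    (∀ (ν : Measure ℝ) [IsProbabilityMeasure ν],
      HasLimitLaw P (K Δ G η) ν ↔ HasLimitLaw P (Krank Δ G η κ) ν) ∧
    (∀ (ν : Measure ℝ) [IsProbabilityMeasure ν],
      HasLimitLaw P (Krank Δ G η κ) ν ↔ HasLimitLaw P (Kstar Δ G η κ α β κ) ν) ∧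
    -- the variances
    Asymptotics.IsEquivalent atTop
      (fun r : ℝ => variance (K Δ G η r) P) (fun r : ℝ => variance (Krank Δ G η κ r) P) ∧
    Asymptotics.IsEquivalent atTop
      (fun r : ℝ => variance (Krank Δ G η κ r) P)
      (fun r : ℝ => variance (Kstar Δ G η κ α β κ r) P) := by
  have hκ1 : 1 ≤ κ := hκ.1.1
  have hκ0 : (0 : ℝ) < κ := by exact_mod_cast hκ1
  have hακ' : α * κ < d := (lt_div_iff₀ hκ0).1 hακ
  have hαβ : α < β := by
    have : α * 1 ≤ α * κ := mul_le_mul_of_nonneg_left (by exact_mod_cast hκ1) hα.le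
    linarith
  have hn : 0 < n := by
    obtain ⟨v, -, -, h⟩ := hv
    rcases Nat.eq_zero_or_pos n with rfl | hn
    · simp at h
      omega
    · exact hn
  have hvol : 0 < volume.real Δ := by
    refine ENNReal.toReal_pos (ne_of_gt ?_) hΔ.isCompact.measure_lt_top.ne
    exact (isOpen_interior.measure_pos volume ⟨0, hΔ.zero_mem⟩).trans_le
      (measure_mono interior_subset)
  have hcomp := hΔ.isCompact
  have hfin := isFiniteMeasure_windowMeasure hcomp
  have hmem {v : Fin m ⊕ Fin n → ℕ} := mem_Nstar_iff (v := v) hα hαβ hv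
  set T := Nstar G κ α β κ with hT
  set S := multiIndices (Fin m ⊕ Fin n) κ with hS
  have hTS : T ⊆ S := by
    intro v hvT
    have := hmem.1 hvT
    rw [hS, mem_multiIndices, Fintype.sum_sum_type, this.2.1, this.2.2, zero_add]
  have hTκ : ∀ v ∈ T, ∑ j, v (Sum.inl j) = 0 ∧ ∑ j, v (Sum.inr j) = κ :=
    fun v h => (hmem.1 h).2
  have hzero : ∀ v ∈ S, v ≠ 0 := by
    rintro _ h rfl
    rw [hS, mem_multiIndices] at h
    simp at h
    omega
  -- Minimality of the rank excludes orders from `1` to `κ - 1`, and the zero mean excludes order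
  -- `0`; order `κ` with no degree in the first `m` variables lies in `T`.
  have hoff : ∀ v, hermiteCoeff G v ≠ 0 → v ∉ T →
      ∑ j, v (Sum.inl j) ≠ 0 ∨ κ + 1 ≤ ∑ j, v (Sum.inr j) := by
    intro v h1 h2
    by_contra! h3
    have hord : κ ≤ ∑ j, v j := by
      refine hκ.2 ⟨?_, v, mem_multiIndices.2 rfl, h1⟩
      by_contra! h4
      have h5 : v = 0 := by
        ext j
        exact (Finset.sum_eq_zero_iff.1 (Nat.lt_one_iff.1 h4)) j (Finset.mem_univ j)
      rw [h5, ← integral_eq_hermiteCoeff_zero] at h1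
      exact h1 hG₀
    rw [Fintype.sum_sum_type, h3.1] at hord
    exact h2 (hmem.2 ⟨h1, h3.1, by omega⟩)
  set c := ∑ v ∈ T, hermiteCoeff G v ^ 2 / (multiFactorial v : ℝ) with hc
  have hcpos : 0 < c := by
    obtain ⟨v, h1, h2, h3⟩ := hv
    rw [mem_multiIndices, Fintype.sum_sum_type, h3] at h1
    refine Finset.sum_pos (fun u hu => ?_) ⟨v, hmem.2 ⟨h2.1, by omega, h3⟩⟩
    exact div_pos (by have := (hmem.1 hu).1; positivity) (multiFactorial_pos u)
  set A : ℝ → ℝ := fun r =>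
    ∫ z, corr α L₂ (z.1 - z.2) ^ κ ∂((windowMeasure Δ r).prod (windowMeasure Δ r)) with hA
  have hApos : ∀ r, 0 < r → 0 < A r := fun r hr => integral_corr_pow_pos hη hn hL₂ hcomp hvol hr
  have hGS := memLp_hermitePartial G S
  have hGT := memLp_hermitePartial G T
  have mean {F : (Fin m ⊕ Fin n → ℝ) → ℝ} (hF : MemLp F 2 (stdGauss (Fin m ⊕ Fin n)))
      (h0 : ∫ w, F w ∂(stdGauss (Fin m ⊕ Fin n)) = 0) {Z : ℝ → Ω → ℝ}
      (hZ : ∀ r, fieldIntegral η (windowMeasure Δ r) F =ᵐ[P] Z r) (r : ℝ) :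
      MemLp (Z r) 2 P ∧ ∫ ω, Z r ω ∂P = 0 := by
    refine ⟨(memLp_fieldIntegral hη.measurable hη.map_eq_stdGauss _ hF).ae_eq (hZ r), ?_⟩
    rw [← integral_congr_ae (hZ r),
      integral_fieldIntegral hη.measurable hη.map_eq_stdGauss _ hF, h0, mul_zero]
  have lower {F : (Fin m ⊕ Fin n → ℝ) → ℝ} (hF : MemLp F 2 (stdGauss (Fin m ⊕ Fin n)))
      (h0 : ∀ v ∈ T, hermiteCoeff F v = hermiteCoeff G v) {Z : ℝ → Ω → ℝ}
      (hZ : ∀ r, fieldIntegral η (windowMeasure Δ r) F =ᵐ[P] Z r) (r : ℝ) :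
      c * A r ≤ ∫ ω, Z r ω ^ 2 ∂P := by
    refine (le_integral_fieldIntegral_sq hη hcomp hL₁ hL₂ r hF hTκ h0).trans (le_of_eq ?_)
    refine integral_congr_ae ?_
    filter_upwards [hZ r] with ω h
    rw [h]
  have zK : ∀ r, fieldIntegral η (windowMeasure Δ r) G =ᵐ[P] K Δ G η r := fun r => ae_eq_rfl
  have zS : ∀ r, fieldIntegral η (windowMeasure Δ r) (hermitePartial G S) =ᵐ[P] Krank Δ G η κ r :=
    fun r => hη.hermiteSum_ae hcomp S r
  have zT : ∀ r, fieldIntegral η (windowMeasure Δ r) (hermitePartial G T) =ᵐ[P]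
      Kstar Δ G η κ α β κ r := fun r => hη.hermiteSum_ae hcomp T r
  classical
  have cS (v) := hermiteCoeff_hermitePartial G S v
  have cT (v) := hermiteCoeff_hermitePartial G T v
  have iS : ∫ w, hermitePartial G S w ∂(stdGauss (Fin m ⊕ Fin n)) = 0 := by
    rw [integral_eq_hermiteCoeff_zero, cS, if_neg fun h => hzero 0 h rfl]
  have iT : ∫ w, hermitePartial G T w ∂(stdGauss (Fin m ⊕ Fin n)) = 0 := by
    rw [integral_eq_hermiteCoeff_zero, cT, if_neg fun h => hzero 0 (hTS h) rfl]
  have mK := mean hG hG₀ zK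
  have mS := mean hGS iS zS
  have mT := mean hGT iT zT
  have lK := lower hG (fun _ _ => rfl) zK
  have lS := lower hGS (fun v h => by rw [cS, if_pos (hTS h)]) zS
  have lT := lower hGT (fun v h => by rw [cT, if_pos h]) zT
  have pos {Z : ℝ → Ω → ℝ} (h : ∀ r, c * A r ≤ ∫ ω, Z r ω ^ 2 ∂P) (r : ℝ) (hr : 0 < r) :
      0 < ∫ ω, Z r ω ^ 2 ∂P := (mul_pos hcpos (hApos r hr)).trans_le (h r)
  -- One estimate serves both comparisons with `Kstar`: `F` is `G` or its order-`κ` part, and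
  -- differs from the leading part only in coefficients off `T`.
  have ratio {F : (Fin m ⊕ Fin n → ℝ) → ℝ} (hF : MemLp F 2 (stdGauss (Fin m ⊕ Fin n)))
      (h0 : ∀ v, hermiteCoeff F v - hermiteCoeff (hermitePartial G T) v ≠ 0 →
        hermiteCoeff G v ≠ 0 ∧ v ∉ T) {Z : ℝ → Ω → ℝ}
      (hZ : ∀ r, fieldIntegral η (windowMeasure Δ r) F =ᵐ[P] Z r) :
      Tendsto (fun r => (∫ ω, (Z r ω - Kstar Δ G η κ α β κ r ω) ^ 2 ∂P) /
        ∫ ω, Kstar Δ G η κ α β κ r ω ^ 2 ∂P) atTop (𝓝 0) := by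
    have hD := hF.sub hGT
    set q := ∫ w, (F w - hermitePartial G T w) ^ 2 ∂(stdGauss (Fin m ⊕ Fin n)) with hq
    have lim := (tendsto_majorant_ratio hη hn hL₁ hL₂ hcomp hvol hκ1 hα hακ' hβ).const_mul (q / c)
    rw [mul_zero] at lim
    refine squeeze_zero' (Eventually.of_forall fun r => div_nonneg
      (integral_nonneg fun _ => sq_nonneg _) (integral_nonneg fun _ => sq_nonneg _)) ?_ lim
    filter_upwards [eventually_gt_atTop 0] with r hr
    have up := integral_fieldIntegral_sq_le_majorant (κ := κ) hη hcomp hn hL₁ hL₂ r hD fun v hv0 => by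
      have h1 : hermiteCoeff F v - hermiteCoeff (hermitePartial G T) v ≠ 0 := by
        rw [← hermiteCoeff_sub hF hGT]
        exact hv0
      exact hoff v (h0 v h1).1 (h0 v h1).2
    have e : ∫ ω, (Z r ω - Kstar Δ G η κ α β κ r ω) ^ 2 ∂P =
        ∫ ω, fieldIntegral η (windowMeasure Δ r) (F - hermitePartial G T) ω ^ 2 ∂P := by
      refine integral_congr_ae ?_
      filter_upwards [hZ r, zT r, fieldIntegral_sub_ae hη.measurable hη.map_eq_stdGauss
        (windowMeasure Δ r) hF hGT] with ω h1 h2 h3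
      rw [← h1, ← h2, ← h3]
      rfl
    rw [e]
    have hA0 := hApos r hr
    calc _ ≤ (q * ∫ z, majorant α β L₁ L₂ κ (z.1 - z.2)
          ∂((windowMeasure Δ r).prod (windowMeasure Δ r))) / (c * A r) :=
        div_le_div₀ ((integral_nonneg fun _ => sq_nonneg _).trans up) up (mul_pos hcpos hA0) (lT r)
      _ = _ := mul_div_mul_comm _ _ _ _
  have conclK := isEquivalent_and_hasLimitLaw_iff (fun r => (mK r).1) (fun r => (mT r).1)
    (fun r => (mK r).2) (fun r => (mT r).2) (pos lK) (pos lT) (ratio hG (fun v h => by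
      rw [cT] at h
      split_ifs at h with hvT
      · simp at h
      · exact ⟨by simpa using h, hvT⟩) zK)
  have conclS := isEquivalent_and_hasLimitLaw_iff (fun r => (mS r).1) (fun r => (mT r).1)
    (fun r => (mS r).2) (fun r => (mT r).2) (pos lS) (pos lT) (ratio hGS (fun v h => by
      rw [cT, cS] at h
      split_ifs at h with hvS hvT hvT
      · simp at h
      · exact ⟨by simpa using h, hvT⟩
      · exact absurd (hTS hvT) hvS
      · simp at h) zS)
  have vpos {Z : ℝ → Ω → ℝ} (h : ∀ r, MemLp (Z r) 2 P ∧ ∫ ω, Z r ω ∂P = 0)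
      (hl : ∀ r, c * A r ≤ ∫ ω, Z r ω ^ 2 ∂P) (r : ℝ) (hr : 0 < r) :
      MemLp (Z r) 2 P ∧ 0 < variance (Z r) P := by
    refine ⟨(h r).1, ?_⟩
    rw [variance_of_integral_eq_zero (h r).1.aestronglyMeasurable.aemeasurable (h r).2]
    exact pos hl r hr
  -- `K` and `Krank` are compared through `Kstar`, by transitivity.
  refine ⟨fun r hr => ⟨ae_integrable_field hη.measurable hη.map_eq_stdGauss (windowMeasure Δ r) hG,
    fun v => ae_integrable_field hη.measurable hη.map_eq_stdGauss (windowMeasure Δ r)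
      (memLp_hermiteProd v), vpos mK lK r hr, vpos mS lS r hr, vpos mT lT r hr⟩,
    fun ν _ => (conclK.2 ν).trans (conclS.2 ν).symm, fun ν _ => conclS.2 ν,
    conclK.1.trans conclS.1.symm, conclS.1⟩
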